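/- Let $R$ be an associative ring with $1$ and a pseudo-involution, i.e. an additive map $a\mapsto\bar a$ with $\bar 1$ invertible, $\bar{\bar a}=a$ and $\overline{ab}=\bar b\,\bar 1^{-1}\bar a$. Let $V$ be a right $R$-module with an anti-Hermitian form $B$ (biadditive, $B(ua,vb)=\bar a\bar 1^{-1}B(u,v)b$, $B(u,v)=-\overline{B(v,u)}$), and let $\mathfrak L$ be an odd form parameter: a subgroup of the Heisenberg group $V\times R$, $(u,a)\dotplus(v,b)=(u+v,a+b+B(u,v))$, that contains all $(0,a+\bar a)$, is contained in $\{(u,a): a=\bar a+B(u,u)\}$, and is stable under $(u,a)\leftharpoonup b=(ub,\bar b\bar 1^{-1}ab)$. For $n\ge 3$ let $\Omega=\{1,\dots,n,-n,\dots,-1\}$, $\varepsilon_i=\bar 1^{-1}$ for $i>0$, $\varepsilon_i=-1$ for $i<0$. Let $H^n$ be the free right module on $e_i$, $i\in\Omega$, with the anti-Hermitian form such that $B(e_i,e_{-i})=1$ for $i>0$ and all other pairs $e_i,e_j$ with $j\ne -i$ are orthogonal, and write $(\cdot,\cdot)$ for the form of the orthogonal sum $H^n\oplus V$. The elementary odd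 unitary group $\mathrm{EU}(2n,R,\mathfrak L)$ is the group of automorphisms of $H^n\oplus V$ generated by the transvections $T_{ij}(a): w\mapsto w+e_{-j}\varepsilon_{-j}\bar a\bar 1^{-1}(e_i,w)-e_i a\varepsilon_j(e_{-j},w)$ for $i\ne\pm j$, $a\in R$, and $T_i(u,b): w\mapsto w-e_i\varepsilon_i(u,w)-e_i\varepsilon_i b\varepsilon_{-i}(e_i,w)+u\varepsilon_{-i}(e_i,w)$ for $(u,b)\in\mathfrak L$. The odd unitary Steinberg group $\mathrm{StU}(2n,R,\mathfrak L)$ is the group with generators $X_{ij}(a)$ ($i\neq\pm j$, $a\in R$) and $X_i(\xi)$ ($\xi\in\mathfrak L$) and relations (all the indices in $\Omega$ such that the symbols make sense, $[x,y]=xyx^{-1}y^{-1}$): $X_{ij}(a)=X_{-j,-i}(\varepsilon_{-j}\bar a\varepsilon_i)$; $X_{ij}(a)X_{ij}(b)=X_{ij}(a+b)$; $X_i(\xi)X_i(\zeta)=X_i(\xi\dotplus\zeta)$; $[X_{ij}(a),X_{hk}(b)]=1$ for $h\notin\{j,-i\}$, $k\notin\{i,-j\}$; $[X_i(\xi),X_{jk}(a)]=1$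 for $j\ne-i$, $k\ne i$; $[X_{ij}(a),X_{jk}(b)]=X_{ik}(ab)$; $[X_i(u,a),X_j(v,b)]=X_{i,-j}(\varepsilon_iB(u,v))$ for $i\ne\pm j$; $[X_i(u,a),X_i(v,b)]=X_i(0,B(u,v)-B(v,u))$; $[X_i(u,a),X_{-i,j}(b)]=X_{ij}(\varepsilon_iab)\,X_{-j}((u,-\bar a)\leftharpoonup b)$; $[X_{ij}(a),X_{j,-i}(b)]=X_i(0,-\varepsilon_{-i}\bar 1ab+\bar b\bar 1^{-1}\bar a\varepsilon_i)$. These relations hold for the transvections, so there is a natural epimorphism $\mathrm{StU}(2n,R,\mathfrak L)\to\mathrm{EU}(2n,R,\mathfrak L)$, $X_{ij}(a)\mapsto T_{ij}(a)$, $X_i(\xi)\mapsto T_i(\xi)$; its kernel is $\mathrm{K_2U}(2n,R,\mathfrak L)$. For $n=\infty$, the groups $\mathrm{StU}(R,\mathfrak L)$, $\mathrm{EU}(R,\mathfrak L)$ and $\mathrm{K_2U}(R,\mathfrak L)$ are the direct limits of these groups along the natural stabilization maps. The Schur multiplier $\mathrm M(G)$ of a perfect group $G$ is the kernel of its universal central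 extension $\pi:U\to G$ (a surjection with central kernel such that for every surjection $\epsilon:H\to G$ with central kernel there is a unique homomorphism $\eta:U\to H$ with $\epsilon\eta=\pi$). **Theorem 3.** Let $n\ge5$ or $n=\infty$, and suppose that $\mathrm{K_2U}(2n,R,\mathfrak L)$ is contained in the center of $\mathrm{StU}(2n,R,\mathfrak L)$. Then $\mathrm{K_2U}(2n,R,\mathfrak L)=\mathrm M(\mathrm{EU}(2n,R,\mathfrak L))$; more precisely, $\mathrm{StU}(2n,R,\mathfrak L)\to\mathrm{EU}(2n,R,\mathfrak L)$ is a universal central extension with kernel $\mathrm{K_2U}(2n,R,\mathfrak L)$. The centrality assumption holds when $n=\infty$, and when $n\ge5$ is finite and the stabilization map $\mathrm{K_2U}(2n-2,R,\mathfrak L)\to\mathrm{K_2U}(2n,R,\mathfrak L)$ is surjective. In particular $\mathrm{K_2U}(R,\mathfrak L)\cong\mathrm H_2(\mathrm{EU}(R,\mathfrak L),\mathbb Z)$. -/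

import Mathlib

open scoped RightActions commutatorElement

universe u v w

namespace OddUnitary

/-! ### Pseudo-involutions, anti-Hermitian forms, odd form parameters -/

/-- A pseudo-involution on an associative unital ring: an additive map `a ↦ ā` with `1̄` invertible,
`a̿ = a` and `(ab)‾ = b̄ 1̄⁻¹ ā`. -/
structure PseudoInvolution (R : Type u) [Ring R] where
  bar : R →+ R
  isUnit_bar_one : IsUnit (bar 1)
  bar_bar : ∀ a, bar (bar a) = a
  bar_mul : ∀ a b, bar (a * b) = bar b * Ring.inverse (bar 1) * bar a

namespace PseudoInvolution

variable {R : Type u} [Ring R] (J : PseudoInvolution R)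

/-- The element `1̄⁻¹`. -/
noncomputable def inv : R := Ring.inverse (J.bar 1)

lemma bar_one_mul_inv : J.bar 1 * J.inv = 1 := Ring.mul_inverse_cancel _ J.isUnit_bar_one

lemma inv_mul_bar_one : J.inv * J.bar 1 = 1 := Ring.inverse_mul_cancel _ J.isUnit_bar_one

lemma bar_mul' (a b : R) : J.bar (a * b) = J.bar b * J.inv * J.bar a := J.bar_mul a b

lemma bar_one_mul_inv_assoc (x : R) : J.bar 1 * (J.inv * x) = x := by
  rw [← mul_assoc, bar_one_mul_inv, one_mul]

lemma inv_mul_bar_one_assoc (x : R) : J.inv * (J.bar 1 * x) = x := by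
  rw [← mul_assoc, inv_mul_bar_one, one_mul]

lemma bar_inv : J.bar J.inv = J.bar 1 * J.bar 1 := by
  have h := J.bar_mul' (J.bar 1) J.inv
  rw [J.bar_one_mul_inv, J.bar_bar, mul_one] at h
  calc J.bar J.inv = (J.bar J.inv * J.inv) * J.bar 1 := by
        rw [mul_assoc, inv_mul_bar_one, mul_one]
    _ = J.bar 1 * J.bar 1 := by rw [← h]

end PseudoInvolution

/-- An anti-Hermitian form on a right `R`-module `V`: a biadditive map `B : V × V → R` with
`B(ua, vb) = ā 1̄⁻¹ B(u, v) b` and `B(u, v) = - (B(v, u))‾`. -/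
structure AntiHermitianForm {R : Type u} [Ring R] (J : PseudoInvolution R)
    (V : Type v) [AddCommGroup V] [Module Rᵐᵒᵖ V] where
  toFun : V →+ V →+ R
  map_smul_smul : ∀ (u v : V) (a b : R),
    toFun (u <• a) (v <• b) = J.bar a * J.inv * toFun u v * b
  neg_bar : ∀ u v : V, toFun u v = - J.bar (toFun v u)

variable {R : Type u} [Ring R] {J : PseudoInvolution R}
  {V : Type v} [AddCommGroup V] [Module Rᵐᵒᵖ V]

instance : CoeFun (AntiHermitianForm J V) (fun _ => V → V →+ R) := ⟨fun B => ⇑B.toFun⟩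

lemma AntiHermitianForm.smul_right (B : AntiHermitianForm J V) (u v : V) (b : R) :
    B u (v <• b) = B u v * b := by
  have h := B.map_smul_smul u v 1 b
  rw [J.bar_one_mul_inv, one_mul] at h
  simpa using h

lemma AntiHermitianForm.smul_left (B : AntiHermitianForm J V) (u v : V) (a : R) :
    B (u <• a) v = J.bar a * J.inv * B u v := by
  have h := B.map_smul_smul u v a 1
  simpa using h

/-- The underlying set `V × R` of the Heisenberg group of the form `B`. -/
@[ext]
structure Heisenberg (B : AntiHermitianForm J V) where
  vec : V
  scal : R

namespace Heisenberg

variable {B : AntiHermitianForm J V}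

/-- The composition `(u, a) ∔ (v, b) = (u + v, a + b + B(u, v))`. -/
instance : Add (Heisenberg B) := ⟨fun x y => ⟨x.vec + y.vec, x.scal + y.scal + B x.vec y.vec⟩⟩

instance : Zero (Heisenberg B) := ⟨⟨0, 0⟩⟩

instance : Neg (Heisenberg B) := ⟨fun x => ⟨-x.vec, -x.scal + B x.vec x.vec⟩⟩

@[simp] lemma add_vec (x y : Heisenberg B) : (x + y).vec = x.vec + y.vec := rfl
@[simp] lemma add_scal (x y : Heisenberg B) :
    (x + y).scal = x.scal + y.scal + B x.vec y.vec := rfl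
@[simp] lemma zero_vec : (0 : Heisenberg B).vec = 0 := rfl
@[simp] lemma zero_scal : (0 : Heisenberg B).scal = 0 := rfl
@[simp] lemma neg_vec (x : Heisenberg B) : (-x).vec = -x.vec := rfl
@[simp] lemma neg_scal (x : Heisenberg B) : (-x).scal = -x.scal + B x.vec x.vec := rfl

/-- The Heisenberg group (written additively, in general not commutative). -/
instance : AddGroup (Heisenberg B) :=
  AddGroup.ofLeftAxioms
    (fun x y z => by ext <;> simp <;> abel)
    (fun x => by ext <;> simp)
    (fun x => by ext <;> simp)

/-- The right action `(u, a) ↼ b = (ub, b̄ 1̄⁻¹ a b)` of `R` on the Heisenberg group. -/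
noncomputable def act (x : Heisenberg B) (b : R) : Heisenberg B :=
  ⟨x.vec <• b, J.bar b * J.inv * x.scal * b⟩

/-- The minimal odd form parameter, as a set. -/
def minParameter (B : AntiHermitianForm J V) : Set (Heisenberg B) :=
  {x | ∃ a : R, x = ⟨0, a + J.bar a⟩}

/-- The maximal odd form parameter, as a set. -/
def maxParameter (B : AntiHermitianForm J V) : Set (Heisenberg B) :=
  {x | x.scal = J.bar x.scal + B x.vec x.vec}

end Heisenberg

/-- An odd form parameter: a subgroup of the Heisenberg group between the minimal and the maximal
one and stable under the action of `R`. -/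
structure OddFormParameter (B : AntiHermitianForm J V) extends AddSubgroup (Heisenberg B) where
  min_subset : Heisenberg.minParameter B ⊆ carrier
  subset_max : carrier ⊆ Heisenberg.maxParameter B
  act_mem : ∀ x ∈ carrier, ∀ b : R, x.act b ∈ carrier

variable {B : AntiHermitianForm J V}

namespace OddFormParameter

variable (L : OddFormParameter B)

/-- The pair `(u, -ā)` lies in the form parameter together with `(u, a)`. -/
lemma neg_bar_mem (x : L.toAddSubgroup) :
    (⟨x.1.vec, -J.bar x.1.scal⟩ : Heisenberg B) ∈ L.toAddSubgroup := by
  have h1 : (-x.1).act (-1) ∈ L.toAddSubgroup := L.act_mem _ (L.toAddSubgroup.neg_mem x.2) _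
  have h2 : x.1.scal = J.bar x.1.scal + B x.1.vec x.1.vec := L.subset_max x.2
  convert h1 using 1
  ext
  · simp [Heisenberg.act]
  · simp only [Heisenberg.act, Heisenberg.neg_scal, map_neg, neg_mul, J.bar_one_mul_inv]
    conv_rhs => rw [h2]
    simp

lemma min_mem (a : R) : (⟨0, a + J.bar a⟩ : Heisenberg B) ∈ L.toAddSubgroup :=
  L.min_subset ⟨a, rfl⟩

/-- The element `(u, -ā) ↼ b` of the form parameter. -/
noncomputable def conjAct (x : L.toAddSubgroup) (b : R) : L.toAddSubgroup :=
  ⟨(⟨x.1.vec, -J.bar x.1.scal⟩ : Heisenberg B).act b, L.act_mem _ (L.neg_bar_mem x) b⟩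

lemma commutator_mem (u v : V) :
    (⟨0, B u v - B v u⟩ : Heisenberg B) ∈ L.toAddSubgroup := by
  have h := L.min_mem (B u v)
  rwa [show J.bar (B u v) = - B v u by rw [B.neg_bar v u, neg_neg], ← sub_eq_add_neg] at h

end OddFormParameter

/-! ### The hyperbolic space `H^n ⊕ V` and the elementary transvections -/

/-- The index set `Ω = {1, …, n, -n, …, -1}`; the pair `(k, true)` stands for `k + 1` and
`(k, false)` for `-(k + 1)`. -/
abbrev Idx (n : ℕ) : Type := Fin n × Bool

namespace Idx

variable {n m : ℕ}

/-- The index `-i`. -/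
def opp (i : Idx n) : Idx n := (i.1, !i.2)

@[simp] lemma opp_opp (i : Idx n) : i.opp.opp = i := by simp [opp]

lemma opp_ne (i : Idx n) : i.opp ≠ i := fun h => by
  have := congrArg Prod.snd h
  simp [opp] at this

lemma opp_inj {i j : Idx n} : i.opp = j.opp ↔ i = j :=
  ⟨fun h => by rw [← opp_opp i, h, opp_opp], fun h => by rw [h]⟩

lemma opp_eq_iff {i j : Idx n} : i.opp = j ↔ i = j.opp :=
  ⟨fun h => by rw [← h, opp_opp], fun h => by rw [h, opp_opp]⟩

/-- The condition `i ∉ {j, -j}`. -/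
def Indep (i j : Idx n) : Prop := i ≠ j ∧ i ≠ j.opp

lemma Indep.symm {i j : Idx n} (h : Indep i j) : Indep j i :=
  ⟨h.1.symm, fun e => h.2 (by rw [e, opp_opp])⟩

lemma Indep.opp_right {i j : Idx n} (h : Indep i j) : Indep i j.opp :=
  ⟨h.2, by rw [opp_opp]; exact h.1⟩

lemma Indep.opp_left {i j : Idx n} (h : Indep i j) : Indep i.opp j := h.symm.opp_right.symm

lemma Indep.of_opp_left {i j : Idx n} (h : Indep i.opp j) : Indep i j := by
  simpa using h.opp_left

/-- The inclusion of the index set for `n` into the index set for `m ≥ n`. -/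
def castLE (h : n ≤ m) (i : Idx n) : Idx m := (Fin.castLE h i.1, i.2)

lemma castLE_injective (h : n ≤ m) : Function.Injective (castLE h) := fun i j e => by
  obtain ⟨e1, e2⟩ := Prod.ext_iff.mp e
  exact Prod.ext (Fin.castLE_injective h e1) e2

@[simp] lemma castLE_opp (h : n ≤ m) (i : Idx n) : castLE h i.opp = (castLE h i).opp := rfl

lemma Indep.castLE {i j : Idx n} (hij : Indep i j) (h : n ≤ m) :
    Indep (castLE h i) (castLE h j) :=
  ⟨fun e => hij.1 (castLE_injective h e), fun e => hij.2 (castLE_injective h e)⟩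

end Idx

/-- `ε_i = 1̄⁻¹` for positive `i` and `ε_i = -1` for negative `i`. -/
noncomputable def eps (J : PseudoInvolution R) {n : ℕ} (i : Idx n) : R :=
  if i.2 then J.inv else -1

/-- The underlying right module of `H^n ⊕ V`: coordinates in the basis `e_i`, and a vector
of `V`. -/
abbrev HypSpace (R : Type u) (V : Type v) (n : ℕ) : Type (max u v) := (Idx n → R) × V

/-- The basis vector `e_i`. -/
def e (R : Type u) [Ring R] (V : Type v) [AddCommGroup V] {n : ℕ} (i : Idx n) : HypSpace R V n :=
  (Pi.single i 1, 0)

/-- The form of the orthogonal sum `H^n ⊕ V`, where `B(e_k, e_{-k}) = 1`, `B(e_{-k}, e_k) = -1̄`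
for positive `k`, and all the other pairs of basis vectors are orthogonal. -/
noncomputable def hypForm (B : AntiHermitianForm J V) {n : ℕ} (x y : HypSpace R V n) : R :=
  ∑ k : Fin n, (J.bar (x.1 (k, true)) * J.inv * 1 * y.1 (k, false)
    + J.bar (x.1 (k, false)) * J.inv * (-J.bar 1) * y.1 (k, true)) + B x.2 y.2

section transvections

variable {n : ℕ}

lemma eps_mul_eps_opp (i : Idx n) : eps J i * eps J i.opp = -J.inv := by
  rcases i with ⟨k, _ | _⟩ <;> simp [eps, Idx.opp]

lemma hypForm_e (B : AntiHermitianForm J V) (i : Idx n) (w : HypSpace R V n) :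
    hypForm B (e R V i) w = eps J i * J.bar 1 * w.1 i.opp := by
  rcases i with ⟨k, _ | _⟩
  · simp only [hypForm, e, eps, Idx.opp]
    rw [Finset.sum_eq_single k]
    · simp [mul_assoc, J.bar_one_mul_inv_assoc]
    · intro j _ hj
      simp [hj]
    · simp
  · simp only [hypForm, e, eps, Idx.opp]
    rw [Finset.sum_eq_single k]
    · simp [J.bar_one_mul_inv, J.inv_mul_bar_one]
    · intro j _ hj
      simp [hj]
    · simp

lemma hypForm_vec (B : AntiHermitianForm J V) (u : V) (w : HypSpace R V n) :
    hypForm B ((0, u) : HypSpace R V n) w = B u w.2 := by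
  simp [hypForm]

lemma bar_one_mul_eps (i : Idx n) : J.bar 1 * eps J i = eps J i * J.bar 1 := by
  rcases i with ⟨k, _ | _⟩ <;> simp [eps, J.inv_mul_bar_one, J.bar_one_mul_inv]

lemma inv_mul_eps_mul (i : Idx n) : J.inv * (eps J i * J.bar 1) = eps J i := by
  rw [← bar_one_mul_eps, J.inv_mul_bar_one_assoc]

lemma eps_opp_mul_eps_mul (i : Idx n) : eps J i.opp * (eps J i * J.bar 1) = -1 := by
  have h := eps_mul_eps_opp (J := J) i.opp
  rw [Idx.opp_opp] at h
  rw [← mul_assoc, h, neg_mul, J.inv_mul_bar_one]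

/-- The map `T_{ij}(a) : w ↦ w + e_{-j} ε_{-j} ā 1̄⁻¹ (e_i, w) - e_i a ε_j (e_{-j}, w)`. -/
noncomputable def shortFun (B : AntiHermitianForm J V) (i j : Idx n) (a : R)
    (w : HypSpace R V n) : HypSpace R V n :=
  w + e R V j.opp <• (eps J j.opp * J.bar a * J.inv * hypForm B (e R V i) w)
    - e R V i <• (a * eps J j * hypForm B (e R V j.opp) w)

/-- The map `T_i(u, b) : w ↦ w - e_i ε_i (u, w) - e_i ε_i b ε_{-i} (e_i, w) + u ε_{-i} (e_i, w)`. -/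
noncomputable def longFun (B : AntiHermitianForm J V) (i : Idx n) (ξ : Heisenberg B)
    (w : HypSpace R V n) : HypSpace R V n :=
  w - e R V i <• (eps J i * hypForm B (0, ξ.vec) w)
    - e R V i <• (eps J i * ξ.scal * eps J i.opp * hypForm B (e R V i) w)
    + ((0, ξ.vec) : HypSpace R V n) <• (eps J i.opp * hypForm B (e R V i) w)

lemma e_smul (i : Idx n) (a : R) : e R V i <• a = (Pi.single i a, 0) := by
  ext k
  · simp only [e, Prod.smul_fst, Pi.smul_apply, Pi.single_apply]
    split_ifs <;> simp
  · simp [e]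

lemma shortFun_eq (i j : Idx n) (a : R) (w : HypSpace R V n) :
    shortFun B i j a w =
      (w.1 + Pi.single j.opp (eps J j.opp * J.bar a * eps J i * w.1 i.opp)
        + Pi.single i (a * w.1 j), w.2) := by
  have h1 : eps J j.opp * J.bar a * J.inv * hypForm B (e R V i) w
      = eps J j.opp * J.bar a * eps J i * w.1 i.opp := by
    rw [hypForm_e, ← mul_assoc, mul_assoc (_ * _) J.inv, inv_mul_eps_mul]
  have h2 : a * eps J j * hypForm B (e R V j.opp) w = -(a * w.1 j) := by
    have h := eps_opp_mul_eps_mul (J := J) j.opp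
    rw [Idx.opp_opp] at h
    rw [hypForm_e, ← mul_assoc, mul_assoc a, h, Idx.opp_opp]
    simp
  rw [shortFun, h1, h2, e_smul, e_smul]
  ext k <;> simp [Pi.single_neg]

lemma longFun_eq (i : Idx n) (ξ : Heisenberg B) (w : HypSpace R V n) :
    longFun B i ξ w =
      (w.1 + Pi.single i (eps J i * (ξ.scal * w.1 i.opp - B ξ.vec w.2)),
        w.2 - ξ.vec <• w.1 i.opp) := by
  have h1 : eps J i.opp * hypForm B (e R V i) w = - w.1 i.opp := by
    rw [hypForm_e, ← mul_assoc, eps_opp_mul_eps_mul, neg_one_mul]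
  rw [longFun, mul_assoc _ (eps J i.opp), h1, e_smul, e_smul, hypForm_vec]
  ext k
  · simp only [Prod.fst_add, Prod.fst_sub, Pi.add_apply, Pi.sub_apply, Pi.single_apply,
      Prod.smul_fst, Pi.zero_apply, smul_zero]
    split_ifs
    · noncomm_ring
    · simp
  · simp [sub_eq_add_neg]

lemma shortFun_comp (i j : Idx n) (hij : i.Indep j) (a b : R) (w : HypSpace R V n) :
    shortFun B i j a (shortFun B i j b w) = shortFun B i j (a + b) w := by
  simp only [shortFun_eq]
  have h1 : j ≠ i := hij.1.symm
  have h2 : j ≠ j.opp := j.opp_ne.symm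
  have h3 : i.opp ≠ i := i.opp_ne
  have h4 : i.opp ≠ j.opp := fun h => hij.1 (Idx.opp_inj.mp h)
  ext k
  · simp [Pi.single_apply, h1, h2, h3, h4, mul_add, add_mul]
    split_ifs <;> abel
  · rfl

lemma longFun_comp (i : Idx n) (ξ ζ : Heisenberg B) (w : HypSpace R V n) :
    longFun B i ξ (longFun B i ζ w) = longFun B i (ξ + ζ) w := by
  simp only [longFun_eq]
  have h3 : i.opp ≠ i := i.opp_ne
  ext k
  · simp [Pi.single_apply, h3, mul_add, add_mul, mul_sub, B.smul_right]
    split_ifs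
    · abel
    · simp
  · simp [h3, smul_add]
    abel

lemma shortFun_zero (i j : Idx n) (w : HypSpace R V n) : shortFun B i j 0 w = w := by
  simp [shortFun_eq]

lemma longFun_zero (i : Idx n) (w : HypSpace R V n) : longFun B i 0 w = w := by
  simp [longFun_eq]

/-- The transvection `T_{ij}(a)`, `i ∉ {j, -j}`, as an automorphism of the right module
`H^n ⊕ V`. -/
noncomputable def shortT (B : AntiHermitianForm J V) (i j : Idx n) (hij : i.Indep j) (a : R) :
    LinearMap.GeneralLinearGroup Rᵐᵒᵖ (HypSpace R V n) :=
  LinearMap.GeneralLinearGroup.ofLinearEquiv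
    { toFun := shortFun B i j a
      invFun := shortFun B i j (-a)
      map_add' := fun x y => by
        simp only [shortFun_eq]
        ext k <;> simp [Pi.single_apply, mul_add]
        split_ifs <;> abel
      map_smul' := fun r x => by
        simp only [shortFun_eq]
        ext k <;> simp [Pi.single_apply, mul_assoc]
      left_inv := fun x => by rw [shortFun_comp i j hij, neg_add_cancel, shortFun_zero]
      right_inv := fun x => by rw [shortFun_comp i j hij, add_neg_cancel, shortFun_zero] }

/-- The transvection `T_i(ξ)`, `ξ = (u, b)`, as an automorphism of the right module `H^n ⊕ V`. -/
noncomputable def longT (B : AntiHermitianForm J V) (i : Idx n) (ξ : Heisenberg B) :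
    LinearMap.GeneralLinearGroup Rᵐᵒᵖ (HypSpace R V n) :=
  LinearMap.GeneralLinearGroup.ofLinearEquiv
    { toFun := longFun B i ξ
      invFun := longFun B i (-ξ)
      map_add' := fun x y => by
        simp only [longFun_eq]
        ext k
        · simp [Pi.single_apply, mul_add, mul_sub]
          split_ifs <;> abel
        · simp [add_smul]
          abel
      map_smul' := fun r x => by
        simp only [longFun_eq]
        have := B.smul_right ξ.vec x.2 r.unop
        simp only [MulOpposite.op_unop] at this
        ext k
        · simp [Pi.single_apply, mul_assoc, sub_mul, mul_sub, this]
        · simp [smul_sub, mul_smul]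
      left_inv := fun x => by rw [longFun_comp, neg_add_cancel, longFun_zero]
      right_inv := fun x => by rw [longFun_comp, add_neg_cancel, longFun_zero] }

@[simp] lemma shortT_apply (i j : Idx n) (hij : i.Indep j) (a : R) (w : HypSpace R V n) :
    (shortT B i j hij a).1 w = shortFun B i j a w := rfl

@[simp] lemma longT_apply (i : Idx n) (ξ : Heisenberg B) (w : HypSpace R V n) :
    (longT B i ξ).1 w = longFun B i ξ w := rfl

end transvections

/-! ### The odd unitary Steinberg group -/

/-- The generators `X_{ij}(a)`, `i ∉ {j, -j}`, and `X_i(ξ)`, `ξ ∈ 𝔏`. -/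
inductive Gen (L : OddFormParameter B) (n : ℕ) : Type (max u v)
  | short (i j : Idx n) (hij : i.Indep j) (a : R) : Gen L n
  | long (i : Idx n) (ξ : L.toAddSubgroup) : Gen L n

section relations

variable (L : OddFormParameter B) {n : ℕ}

/-- The free generator `X_{ij}(a)`. -/
def X (i j : Idx n) (hij : i.Indep j) (a : R) : FreeGroup (Gen L n) :=
  FreeGroup.of (Gen.short i j hij a)

variable {L} in
/-- The free generator `X_i(ξ)`. -/
def Y (i : Idx n) (ξ : L.toAddSubgroup) : FreeGroup (Gen L n) :=
  FreeGroup.of (Gen.long i ξ)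

/-- The element `(0, B(u, v) - B(v, u))` of the form parameter. -/
def commParam (ξ ζ : L.toAddSubgroup) : L.toAddSubgroup :=
  ⟨⟨0, B ξ.1.vec ζ.1.vec - B ζ.1.vec ξ.1.vec⟩, L.commutator_mem _ _⟩

lemma shortParam_mem (i : Idx n) (a b : R) :
    (⟨0, -eps J i.opp * J.bar 1 * a * b + J.bar b * J.inv * J.bar a * eps J i⟩ : Heisenberg B)
      ∈ L.toAddSubgroup := by
  convert L.min_mem (-eps J i.opp * J.bar 1 * a * b) using 2
  congr 1
  rcases i with ⟨k, _ | _⟩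
  · simp [eps, Idx.opp, J.inv_mul_bar_one, J.bar_mul']
  · simp [eps, Idx.opp, J.bar_bar, J.bar_mul', mul_assoc]

/-- The element `(0, -ε_{-i} 1̄ a b + b̄ 1̄⁻¹ ā ε_i)` of the form parameter. -/
noncomputable def shortParam (i : Idx n) (a b : R) : L.toAddSubgroup :=
  ⟨⟨0, -eps J i.opp * J.bar 1 * a * b + J.bar b * J.inv * J.bar a * eps J i⟩,
    shortParam_mem L i a b⟩

/-- The Steinberg relations; `Relator L n r` means that the relation `r = 1` is imposed. -/
inductive Relator (n : ℕ) : FreeGroup (Gen L n) → Prop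
  | r0 (i j : Idx n) (hij : i.Indep j) (hji : j.opp.Indep i.opp) (a : R) :
      Relator n (X L i j hij a * (X L j.opp i.opp hji (eps J j.opp * J.bar a * eps J i))⁻¹)
  | r1 (i j : Idx n) (hij : i.Indep j) (a b : R) :
      Relator n (X L i j hij a * X L i j hij b * (X L i j hij (a + b))⁻¹)
  | r2 (i : Idx n) (ξ ζ : L.toAddSubgroup) :
      Relator n (Y i ξ * Y i ζ * (Y i (ξ + ζ))⁻¹)
  | r3 (i j h k : Idx n) (hij : i.Indep j) (hhk : h.Indep k)
      (h1 : h ≠ j) (h2 : h ≠ i.opp) (h3 : k ≠ i) (h4 : k ≠ j.opp) (a b : R) :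
      Relator n ⁅X L i j hij a, X L h k hhk b⁆
  | r4 (i j k : Idx n) (hjk : j.Indep k) (h1 : j ≠ i.opp) (h2 : k ≠ i)
      (ξ : L.toAddSubgroup) (a : R) :
      Relator n ⁅Y i ξ, X L j k hjk a⁆
  | r5 (i j k : Idx n) (hij : i.Indep j) (hjk : j.Indep k) (hik : i.Indep k) (a b : R) :
      Relator n (⁅X L i j hij a, X L j k hjk b⁆ * (X L i k hik (a * b))⁻¹)
  | r6 (i j : Idx n) (hij : i.Indep j) (hij' : i.Indep j.opp) (ξ ζ : L.toAddSubgroup) :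
      Relator n (⁅Y i ξ, Y j ζ⁆ * (X L i j.opp hij' (eps J i * B ξ.1.vec ζ.1.vec))⁻¹)
  | r7 (i : Idx n) (ξ ζ : L.toAddSubgroup) :
      Relator n (⁅Y i ξ, Y i ζ⁆ * (Y i (commParam L ξ ζ))⁻¹)
  | r8 (i j : Idx n) (hij : i.Indep j) (hij' : i.opp.Indep j) (ξ : L.toAddSubgroup) (b : R) :
      Relator n (⁅Y i ξ, X L i.opp j hij' b⁆ *
        (X L i j hij (eps J i * ξ.1.scal * b) * Y j.opp (L.conjAct ξ b))⁻¹)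
  | r9 (i j : Idx n) (hij : i.Indep j) (hji : j.Indep i.opp) (a b : R) :
      Relator n (⁅X L i j hij a, X L j i.opp hji b⁆ * (Y i (shortParam L i a b))⁻¹)

/-- The odd unitary Steinberg group `StU(2n, R, 𝔏)`. -/
abbrev StU (n : ℕ) : Type (max u v) := PresentedGroup {r | Relator L n r}

/-- The elementary transvection corresponding to a generator. -/
noncomputable def transvection : Gen L n → LinearMap.GeneralLinearGroup Rᵐᵒᵖ (HypSpace R V n)
  | .short i j hij a => shortT B i j hij a
  | .long i ξ => longT B i ξ.1

/-- The odd hyperbolic elementary group `EU(2n, R, 𝔏)`: the group of automorphisms of `H^n ⊕ V`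
generated by the elementary transvections `T_{ij}(a)` and `T_i(ξ)`, `ξ ∈ 𝔏`. (As the generators are
unitary, it does not matter whether the generated subgroup is formed inside the odd hyperbolic
unitary group or inside the group of all linear automorphisms.) -/
noncomputable def EU (n : ℕ) : Subgroup (LinearMap.GeneralLinearGroup Rᵐᵒᵖ (HypSpace R V n)) :=
  Subgroup.closure (Set.range (transvection L))

@[simp] lemma lift_X (i j : Idx n) (hij : i.Indep j) (a : R) :
    FreeGroup.lift (transvection L) (X L i j hij a) = shortT B i j hij a := by
  simp [X, transvection]

@[simp] lemma lift_Y (i : Idx n) (ξ : L.toAddSubgroup) :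
    FreeGroup.lift (transvection L) (Y i ξ) = longT B i ξ.1 := by
  simp [Y, transvection]

lemma GL_ext {f g : LinearMap.GeneralLinearGroup Rᵐᵒᵖ (HypSpace R V n)}
    (h : ∀ w, f.1 w = g.1 w) : f = g :=
  Units.ext (LinearMap.ext h)

lemma commutator_eq_one {G : Type*} [Group G] {x y : G} (h : x * y = y * x) : ⁅x, y⁆ = 1 :=
  commutatorElement_eq_one_iff_mul_comm.mpr h

lemma commutator_mul_inv_eq_one {G : Type*} [Group G] {x y z : G} (h : x * y = z * (y * x)) :
    ⁅x, y⁆ * z⁻¹ = 1 := by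
  rw [mul_inv_eq_one, commutatorElement_def, mul_assoc, ← mul_inv_rev, mul_inv_eq_iff_eq_mul, h]

lemma eps_mul_bar (i : Idx n) : eps J i * J.bar (eps J i) = J.bar 1 := by
  rcases i with ⟨k, _ | _⟩ <;> simp [eps, J.bar_inv, J.inv_mul_bar_one_assoc]

lemma bar_mul_eps (i : Idx n) : J.bar (eps J i) * eps J i = J.bar 1 := by
  rcases i with ⟨k, _ | _⟩ <;> simp [eps, J.bar_inv, J.bar_one_mul_inv, mul_assoc]

lemma eps_mul_bar_assoc (i : Idx n) (x : R) :
    eps J i * (J.bar (eps J i) * x) = J.bar 1 * x := by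
  rw [← mul_assoc, eps_mul_bar]

lemma eps_mul_eps_opp_assoc (i : Idx n) (x : R) :
    eps J i * (eps J i.opp * x) = -(J.inv * x) := by
  rw [← mul_assoc, eps_mul_eps_opp, neg_mul]

lemma eps_opp_mul_eps_assoc (i : Idx n) (x : R) :
    eps J i.opp * (eps J i * x) = -(J.inv * x) := by
  have h := eps_mul_eps_opp_assoc (J := J) i.opp x
  rwa [Idx.opp_opp] at h

lemma bar_mul_eps_assoc (i : Idx n) (x : R) :
    J.bar (eps J i) * (eps J i * x) = J.bar 1 * x := by
  rw [← mul_assoc, bar_mul_eps]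

set_option linter.unusedSimpArgs false in
lemma transvection_relator (r : FreeGroup (Gen L n)) (hr : Relator L n r) :
    FreeGroup.lift (transvection L) r = 1 := by
  cases hr with
  | r0 i j hij hji a =>
    simp only [map_mul, map_inv, lift_X]
    rw [mul_inv_eq_one]
    refine GL_ext fun w => ?_
    change shortFun B _ _ _ _ = shortFun B _ _ _ _
    simp only [shortFun_eq, Idx.opp_opp]
    have h : eps J i * J.bar (eps J j.opp * J.bar a * eps J i) * eps J j.opp = a := by
      simp only [J.bar_mul', J.bar_bar, mul_assoc, eps_mul_bar_assoc, bar_mul_eps,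
        J.bar_one_mul_inv_assoc, J.inv_mul_bar_one, mul_one]
    rw [h]
    ext k
    · simp [add_right_comm]
    · rfl
  | r1 i j hij a b =>
    simp only [map_mul, map_inv, lift_X]
    rw [mul_inv_eq_one]
    exact GL_ext fun w => shortFun_comp i j hij a b w
  | r2 i ξ ζ =>
    simp only [map_mul, map_inv, lift_Y]
    rw [mul_inv_eq_one]
    exact GL_ext fun w => longFun_comp i ξ.1 ζ.1 w
  | r3 i j h k hij hhk h1 h2 h3 h4 a b =>
    simp only [map_commutatorElement, lift_X]
    refine commutator_eq_one (GL_ext fun w => ?_)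
    change shortFun B _ _ _ (shortFun B _ _ _ _) = shortFun B _ _ _ (shortFun B _ _ _ _)
    simp only [shortFun_eq]
    have e1 : i.opp ≠ h := h2.symm
    have e2 : i.opp ≠ k.opp := fun e => h3 (Idx.opp_inj.mp e).symm
    have e3 : h.opp ≠ j.opp := fun e => h1 (Idx.opp_inj.mp e)
    have e4 : h.opp ≠ i := fun e => h2 (Idx.opp_eq_iff.mp e)
    have e5 : j ≠ k.opp := fun e => h4 (Idx.opp_eq_iff.mp e.symm)
    ext l
    · simp [Pi.single_apply, e1, e2, e3, e4, e5, h1.symm, h3, h4]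
      abel
    · rfl
  | r4 i j k hjk h1 h2 ξ a =>
    simp only [map_commutatorElement, lift_X, lift_Y]
    refine commutator_eq_one (GL_ext fun w => ?_)
    change longFun B _ _ (shortFun B _ _ _ _) = shortFun B _ _ _ (longFun B _ _ _)
    simp only [shortFun_eq, longFun_eq]
    have e1 : i.opp ≠ k.opp := fun e => h2 (Idx.opp_inj.mp e).symm
    have e2 : j.opp ≠ i := fun e => h1 (Idx.opp_eq_iff.mp e)
    ext l
    · simp [Pi.single_apply, e1, e2, h1.symm, h2]
      abel
    · simp [Pi.single_apply, e1, h1.symm]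
  | r5 i j k hij hjk hik a b =>
    simp only [map_mul, map_inv, map_commutatorElement, lift_X]
    refine commutator_mul_inv_eq_one (GL_ext fun w => ?_)
    change shortFun B _ _ _ (shortFun B _ _ _ _)
      = shortFun B _ _ _ (shortFun B _ _ _ (shortFun B _ _ _ _))
    simp only [shortFun_eq]
    have n1 := hij.1
    have n2 := hij.2
    have n3 : i.opp ≠ j := fun e => n2 (Idx.opp_eq_iff.mp e)
    have n4 : i.opp ≠ j.opp := fun e => n1 (Idx.opp_inj.mp e)
    have n5 := i.opp_ne
    have n6 := j.opp_ne
    have m1 := hjk.1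
    have m2 := hjk.2
    have m3 : j.opp ≠ k := fun e => m2 (Idx.opp_eq_iff.mp e)
    have m4 : j.opp ≠ k.opp := fun e => m1 (Idx.opp_inj.mp e)
    have l1 := hik.1
    have l2 := hik.2
    have l3 : i.opp ≠ k := fun e => l2 (Idx.opp_eq_iff.mp e)
    have l4 : i.opp ≠ k.opp := fun e => l1 (Idx.opp_inj.mp e)
    have l5 := k.opp_ne
    refine Prod.ext ?_ rfl
    simp [n1, n2, n3, n4, n5, n6, m1, m2, m3, m4, l1, l2, l3, l4, l5, n1.symm, n2.symm, n3.symm,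
      n4.symm, n5.symm, n6.symm, m1.symm, m2.symm, m3.symm, m4.symm, l1.symm, l2.symm, l3.symm,
      l4.symm, l5.symm, mul_add, mul_assoc, Pi.single_add, J.bar_mul', eps_mul_eps_opp_assoc,
      Pi.single_neg]
    abel
  | r6 i j hij hij' ξ ζ =>
    simp only [map_mul, map_inv, map_commutatorElement, lift_X, lift_Y]
    refine commutator_mul_inv_eq_one (GL_ext fun w => ?_)
    change longFun B _ _ (longFun B _ _ _)
      = shortFun B _ _ _ (longFun B _ _ (longFun B _ _ _))
    simp only [shortFun_eq, longFun_eq]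
    have n1 := hij.1
    have n2 := hij.2
    have n3 : i.opp ≠ j := fun e => n2 (Idx.opp_eq_iff.mp e)
    have n4 : i.opp ≠ j.opp := fun e => n1 (Idx.opp_inj.mp e)
    have n5 := i.opp_ne
    have n6 := j.opp_ne
    refine Prod.ext ?_ ?_
    · simp [n1, n2, n3, n4, n5, n6, n1.symm, n2.symm, n3.symm, n4.symm, n5.symm, n6.symm, mul_add,
        mul_sub, mul_assoc, Pi.single_add, Pi.single_sub, J.bar_mul', B.smul_right]
      rw [B.neg_bar ξ.1.vec ζ.1.vec]
      simp [mul_assoc, Pi.single_neg, J.bar_bar, bar_mul_eps_assoc, J.inv_mul_bar_one_assoc]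
      abel
    · simp [n1, n2, n3, n4, n5, n6, n1.symm, n2.symm, n3.symm, n4.symm, n5.symm, n6.symm]
      abel
  | r7 i ξ ζ =>
    simp only [map_mul, map_inv, map_commutatorElement, lift_Y]
    refine commutator_mul_inv_eq_one (GL_ext fun w => ?_)
    change longFun B _ _ (longFun B _ _ _) = longFun B _ _ (longFun B _ _ (longFun B _ _ _))
    rw [longFun_comp, longFun_comp, longFun_comp]
    congr 1
    ext
    · simp [commParam, add_comm]
    · simp [commParam]
      abel
  | r8 i j hij hij' ξ b =>
    simp only [map_mul, map_inv, map_commutatorElement, lift_X, lift_Y]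
    refine commutator_mul_inv_eq_one (GL_ext fun w => ?_)
    change longFun B _ _ (shortFun B _ _ _ _)
      = shortFun B _ _ _ (longFun B _ _ (shortFun B _ _ _ (longFun B _ _ _)))
    simp only [shortFun_eq, longFun_eq]
    have n1 := hij.1
    have n2 := hij.2
    have n3 : i.opp ≠ j := fun e => n2 (Idx.opp_eq_iff.mp e)
    have n4 : i.opp ≠ j.opp := fun e => n1 (Idx.opp_inj.mp e)
    have n5 := i.opp_ne
    have n6 := j.opp_ne
    have hmax : J.bar ξ.1.scal = ξ.1.scal - B ξ.1.vec ξ.1.vec :=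
      eq_sub_of_add_eq (L.subset_max ξ.2).symm
    refine Prod.ext ?_ ?_
    · simp [OddFormParameter.conjAct, Heisenberg.act, n1, n2, n3, n4, n5, n6, n1.symm, n2.symm,
        n3.symm, n4.symm, n5.symm, n6.symm, mul_add, mul_sub, sub_mul, mul_assoc, Pi.single_add, Pi.single_sub,
        Pi.single_neg, J.bar_mul', B.smul_right, B.smul_left, hmax, bar_mul_eps_assoc,
        J.inv_mul_bar_one_assoc, eps_opp_mul_eps_assoc]
      abel
    · simp [OddFormParameter.conjAct, Heisenberg.act, n1, n2, n3, n4, n5, n6, n1.symm, n2.symm, n3.symm, n4.symm, n5.symm, n6.symm, add_smul, mul_smul]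
      abel
  | r9 i j hij hji a b =>
    simp only [map_mul, map_inv, map_commutatorElement, lift_X, lift_Y]
    refine commutator_mul_inv_eq_one (GL_ext fun w => ?_)
    change shortFun B _ _ _ (shortFun B _ _ _ _)
      = longFun B _ _ (shortFun B _ _ _ (shortFun B _ _ _ _))
    simp only [shortFun_eq, longFun_eq]
    have n1 := hij.1
    have n2 := hij.2
    have n3 : i.opp ≠ j := fun e => n2 (Idx.opp_eq_iff.mp e)
    have n4 : i.opp ≠ j.opp := fun e => n1 (Idx.opp_inj.mp e)
    have n5 := i.opp_ne
    have n6 := j.opp_ne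
    refine Prod.ext ?_ ?_
    · simp [shortParam, n1, n2, n3, n4, n5, n6, n1.symm, n2.symm, n3.symm, n4.symm, n5.symm, n6.symm, mul_add,
        mul_sub, add_mul, mul_assoc, Pi.single_add, Pi.single_sub, Pi.single_neg, J.bar_mul', eps_mul_eps_opp_assoc, J.inv_mul_bar_one_assoc]
      abel
    · simp [shortParam]

end relations

/-! ### The natural epimorphism, `K₂U`, and stabilization -/

section stable

variable (L : OddFormParameter B)

/-- The elementary transvection corresponding to a generator, as an element of `EU(2n, R, 𝔏)`. -/
noncomputable def genToEU {n : ℕ} (g : Gen L n) : EU L n :=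
  ⟨transvection L g, Subgroup.subset_closure ⟨g, rfl⟩⟩

lemma lift_genToEU {n : ℕ} (r : FreeGroup (Gen L n)) :
    (FreeGroup.lift (genToEU L) r : LinearMap.GeneralLinearGroup Rᵐᵒᵖ (HypSpace R V n))
      = FreeGroup.lift (transvection L) r := by
  have : (EU L n).subtype.comp (FreeGroup.lift (genToEU L)) = FreeGroup.lift (transvection L) :=
    FreeGroup.ext_hom _ _ fun g => by simp [genToEU]
  exact DFunLike.congr_fun this r

/-- The natural epimorphism `StU(2n, R, 𝔏) → EU(2n, R, 𝔏)` which sends the generators to the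
corresponding elementary transvections. -/
noncomputable def StU.toEU (n : ℕ) : StU L n →* EU L n :=
  PresentedGroup.toGroup (f := genToEU L) (fun r hr =>
    Subtype.val_injective ((lift_genToEU L r).trans (transvection_relator L r hr)))

/-- The group `K₂U(2n, R, 𝔏)`, the kernel of `StU(2n, R, 𝔏) → EU(2n, R, 𝔏)`. -/
noncomputable def K2U (n : ℕ) : Subgroup (StU L n) := (StU.toEU L n).ker

variable {n m k : ℕ}

/-- The generator for `m ≥ n` with the same name. -/
def Gen.castLE (h : n ≤ m) : Gen L n → Gen L m
  | .short i j hij a => .short (i.castLE h) (j.castLE h) (hij.castLE h) a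
  | .long i ξ => .long (i.castLE h) ξ

lemma eps_castLE (h : n ≤ m) (i : Idx n) : eps J (i.castLE h) = eps J i := rfl

lemma map_X (h : n ≤ m) (i j : Idx n) (hij : i.Indep j) (a : R) :
    FreeGroup.map (Gen.castLE L h) (X L i j hij a)
      = X L (i.castLE h) (j.castLE h) (hij.castLE h) a := by
  simp [X, Gen.castLE]

lemma map_Y (h : n ≤ m) (i : Idx n) (ξ : L.toAddSubgroup) :
    FreeGroup.map (Gen.castLE L h) (Y i ξ) = Y (i.castLE h) ξ := by
  simp [Y, Gen.castLE]

lemma Relator.castLE (h : n ≤ m) {r : FreeGroup (Gen L n)} (hr : Relator L n r) :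
    Relator L m (FreeGroup.map (Gen.castLE L h) r) := by
  have inj := Idx.castLE_injective (n := n) (m := m) h
  cases hr with
  | r0 i j hij hji a =>
    simp only [map_mul, map_inv, map_X]
    exact .r0 (i.castLE h) (j.castLE h) _ (hji.castLE h) a
  | r1 i j hij a b =>
    simp only [map_mul, map_inv, map_X]
    exact .r1 _ _ _ a b
  | r2 i ξ ζ =>
    simp only [map_mul, map_inv, map_Y]
    exact .r2 _ ξ ζ
  | r3 i j p q hij hpq h1 h2 h3 h4 a b =>
    simp only [map_commutatorElement, map_X]
    exact .r3 (i.castLE h) (j.castLE h) (p.castLE h) (q.castLE h) _ _ (inj.ne h1) (inj.ne h2) (inj.ne h3) (inj.ne h4) a b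
  | r4 i j q hjq h1 h2 ξ a =>
    simp only [map_commutatorElement, map_X, map_Y]
    exact .r4 (i.castLE h) (j.castLE h) (q.castLE h) _ (inj.ne h1) (inj.ne h2) ξ a
  | r5 i j q hij hjq hiq a b =>
    simp only [map_mul, map_inv, map_commutatorElement, map_X]
    exact .r5 _ _ _ _ _ _ a b
  | r6 i j hij hij' ξ ζ =>
    simp only [map_mul, map_inv, map_commutatorElement, map_X, map_Y]
    exact .r6 (i.castLE h) (j.castLE h) (hij.castLE h) (hij'.castLE h) ξ ζ
  | r7 i ξ ζ =>
    simp only [map_mul, map_inv, map_commutatorElement, map_Y]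
    exact .r7 _ ξ ζ
  | r8 i j hij hij' ξ b =>
    simp only [map_mul, map_inv, map_commutatorElement, map_X, map_Y]
    exact .r8 (i.castLE h) (j.castLE h) (hij.castLE h) (hij'.castLE h) ξ b
  | r9 i j hij hji a b =>
    simp only [map_mul, map_inv, map_commutatorElement, map_X, map_Y]
    exact .r9 (i.castLE h) (j.castLE h) (hij.castLE h) (hji.castLE h) a b

/-- The natural map `StU(2n, R, 𝔏) → StU(2m, R, 𝔏)`, `n ≤ m`, which sends `X_{ij}(a)` to
`X_{ij}(a)` and `X_i(ξ)` to `X_i(ξ)`. -/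
def StU.stab (h : n ≤ m) : StU L n →* StU L m :=
  PresentedGroup.toGroup (f := fun g => PresentedGroup.of (Gen.castLE L h g)) (fun r hr => by
    have h1 : (PresentedGroup.mk {r | Relator L m r}) (FreeGroup.map (Gen.castLE L h) r) = 1 :=
      PresentedGroup.one_of_mem (Relator.castLE L h hr)
    rw [← h1]
    change _ = ((PresentedGroup.mk {r | Relator L m r}).comp (FreeGroup.map (Gen.castLE L h))) r
    congr 1
    ext g
    simp [PresentedGroup.of])

@[simp] lemma StU.stab_of (h : n ≤ m) (g : Gen L n) :
    StU.stab L h (PresentedGroup.of g) = PresentedGroup.of (Gen.castLE L h g) := by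
  simp [StU.stab]

@[simp] lemma StU.toEU_of (g : Gen L n) :
    (StU.toEU L n (PresentedGroup.of g) : LinearMap.GeneralLinearGroup Rᵐᵒᵖ (HypSpace R V n))
      = transvection L g := by
  simp [StU.toEU, genToEU]

/-- The inclusion `H^n ⊕ V → H^m ⊕ V`, `e_i ↦ e_i`, for `n ≤ m`. -/
def incl (R : Type u) [Ring R] (V : Type v) [AddCommGroup V] [Module Rᵐᵒᵖ V] (_h : n ≤ m) :
    HypSpace R V n →ₗ[Rᵐᵒᵖ] HypSpace R V m where
  toFun w := (fun q => if hq : q.1.1 < n then w.1 (⟨q.1.1, hq⟩, q.2) else 0, w.2)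
  map_add' x y := by
    ext q
    · by_cases hq : q.1.1 < n <;> simp [hq]
    · rfl
  map_smul' r x := by
    ext q
    · by_cases hq : q.1.1 < n <;> simp [hq]
    · rfl

/-- The projection `H^m ⊕ V → H^n ⊕ V` which forgets the coordinates outside `H^n ⊕ V`. -/
def proj (R : Type u) [Ring R] (V : Type v) [AddCommGroup V] [Module Rᵐᵒᵖ V] (h : n ≤ m) :
    HypSpace R V m →ₗ[Rᵐᵒᵖ] HypSpace R V n where
  toFun w := (fun i => w.1 (i.castLE h), w.2)
  map_add' _ _ := rfl
  map_smul' _ _ := rfl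

lemma proj_incl (h : n ≤ m) (w : HypSpace R V n) : proj R V h (incl R V h w) = w := by
  ext q
  · simp [proj, incl, Idx.castLE]
  · rfl

lemma incl_single (h : n ≤ m) (i : Idx n) (a : R) (x : V) :
    incl R V h (Pi.single i a, x) = (Pi.single (i.castLE h) a, x) := by
  refine Prod.ext ?_ rfl
  funext q
  simp only [incl, LinearMap.coe_mk, AddHom.coe_mk, Pi.single_apply]
  by_cases hq : q.1.1 < n
  · have : ((⟨q.1.1, hq⟩, q.2) : Idx n) = i ↔ q = i.castLE h := by
      simp [Prod.ext_iff, Idx.castLE, Fin.ext_iff]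
    simp [hq, this]
  · have : q ≠ i.castLE h := fun e => hq (by rw [e]; exact i.1.2)
    simp [hq, this]

/-- Extension of an automorphism of `H^n ⊕ V` to `H^m ⊕ V` by the identity on the remaining
basis vectors. -/
def extendGL (R : Type u) [Ring R] (V : Type v) [AddCommGroup V] [Module Rᵐᵒᵖ V] (h : n ≤ m) :
    LinearMap.GeneralLinearGroup Rᵐᵒᵖ (HypSpace R V n) →*
      LinearMap.GeneralLinearGroup Rᵐᵒᵖ (HypSpace R V m) :=
  Units.map
    { toFun := fun f => LinearMap.id + incl R V h ∘ₗ (f - LinearMap.id) ∘ₗ proj R V h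
      map_one' := by ext w <;> simp
      map_mul' := fun f g => by
        refine LinearMap.ext fun w => ?_
        simp [proj_incl]
        abel }

lemma extendGL_apply (h : n ≤ m) (f : LinearMap.GeneralLinearGroup Rᵐᵒᵖ (HypSpace R V n))
    (w : HypSpace R V m) :
    (extendGL R V h f).1 w = w + incl R V h (f.1 (proj R V h w) - proj R V h w) := rfl

lemma extendGL_transvection (h : n ≤ m) (g : Gen L n) :
    extendGL R V h (transvection L g) = transvection L (g.castLE L h) := by
  refine GL_ext fun w => ?_
  rw [extendGL_apply]
  cases g with
  | short i j hij a =>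
    change w + incl R V h (shortFun B _ _ _ _ - _) = shortFun B _ _ _ _
    rw [shortFun_eq, shortFun_eq]
    have : ((proj R V h w).1
        + Pi.single j.opp (eps J j.opp * J.bar a * eps J i * (proj R V h w).1 i.opp)
        + Pi.single i (a * (proj R V h w).1 j), (proj R V h w).2) - proj R V h w
        = (Pi.single j.opp (eps J j.opp * J.bar a * eps J i * (proj R V h w).1 i.opp), 0)
        + (Pi.single i (a * (proj R V h w).1 j), 0) := by
      ext q <;> simp
      abel
    rw [this, map_add, incl_single, incl_single]
    ext q
    · simp [proj, eps_castLE, ← Idx.castLE_opp, add_assoc]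
    · simp
  | long i ξ =>
    change w + incl R V h (longFun B _ _ _ - _) = longFun B _ _ _
    rw [longFun_eq, longFun_eq]
    have : ((proj R V h w).1 + Pi.single i (eps J i * (ξ.1.scal * (proj R V h w).1 i.opp
          - B ξ.1.vec (proj R V h w).2)),
        (proj R V h w).2 - ξ.1.vec <• (proj R V h w).1 i.opp) - proj R V h w
        = (Pi.single i (eps J i * (ξ.1.scal * (proj R V h w).1 i.opp
          - B ξ.1.vec (proj R V h w).2)), - ξ.1.vec <• (proj R V h w).1 i.opp) := by
      ext q <;> simp
    rw [this, incl_single]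
    ext q
    · simp [proj, eps_castLE, ← Idx.castLE_opp]
    · simp [proj, ← Idx.castLE_opp, sub_eq_add_neg]

lemma extendGL_mem (h : n ≤ m) (f : EU L n) : extendGL R V h f.1 ∈ EU L m := by
  have : EU L n ≤ (EU L m).comap (extendGL R V h) := by
    refine (Subgroup.closure_le _).mpr ?_
    rintro _ ⟨g, rfl⟩
    refine Subgroup.mem_comap.mpr ?_
    rw [extendGL_transvection]
    exact Subgroup.subset_closure ⟨_, rfl⟩
  exact this f.2

/-- The natural embedding `EU(2n, R, 𝔏) → EU(2m, R, 𝔏)` for `n ≤ m`. -/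
noncomputable def EU.stab (h : n ≤ m) : EU L n →* EU L m :=
  ((extendGL R V h).comp (EU L n).subtype).codRestrict (EU L m) (fun f => extendGL_mem L h f)

lemma EU.coe_stab (h : n ≤ m) (f : EU L n) :
    (EU.stab L h f : LinearMap.GeneralLinearGroup Rᵐᵒᵖ (HypSpace R V m)) = extendGL R V h f.1 :=
  rfl

lemma toEU_stab (h : n ≤ m) (x : StU L n) :
    StU.toEU L m (StU.stab L h x) = EU.stab L h (StU.toEU L n x) := by
  have : (StU.toEU L m).comp (StU.stab L h) = (EU.stab L h).comp (StU.toEU L n) :=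
    PresentedGroup.ext fun g => Subtype.val_injective (by
      simp [EU.coe_stab, extendGL_transvection])
  exact DFunLike.congr_fun this x

/-- The natural map `K₂U(2n, R, 𝔏) → K₂U(2m, R, 𝔏)` for `n ≤ m`. -/
noncomputable def K2U.stab (h : n ≤ m) : K2U L n →* K2U L m :=
  ((StU.stab L h).comp (K2U L n).subtype).codRestrict (K2U L m) (fun x => by
    have hx : StU.toEU L n x.1 = 1 := x.2
    change StU.toEU L m (StU.stab L h x.1) = 1
    rw [toEU_stab, hx, map_one])

lemma K2U.coe_stab (h : n ≤ m) (x : K2U L n) :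
    (K2U.stab L h x : StU L m) = StU.stab L h x.1 :=
  rfl

/-! ### The case `n = ∞` -/

lemma StU.stab_self (x : StU L n) : StU.stab L le_rfl x = x := by
  change StU.stab L le_rfl x = MonoidHom.id _ x
  congr 1
  ext g
  cases g <;> simp [Gen.castLE, Idx.castLE]

lemma StU.stab_stab (h : n ≤ m) (h' : m ≤ k) (x : StU L n) :
    StU.stab L h' (StU.stab L h x) = StU.stab L (h.trans h') x := by
  change ((StU.stab L h').comp (StU.stab L h)) x = _
  congr 1
  ext g
  cases g <;> simp [Gen.castLE, Idx.castLE]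

lemma StU.toEU_surjective (n : ℕ) : Function.Surjective (StU.toEU L n) := by
  rw [← MonoidHom.range_eq_top, eq_top_iff]
  rintro ⟨f, hf⟩ -
  refine Subgroup.closure_induction (p := fun f hf => (⟨f, hf⟩ : EU L n) ∈ (StU.toEU L n).range)
    ?_ ?_ ?_ ?_ hf
  · rintro _ ⟨g, rfl⟩
    exact ⟨PresentedGroup.of g, Subtype.ext (StU.toEU_of L g)⟩
  · exact one_mem _
  · intro x y hx hy h1 h2
    exact mul_mem h1 h2
  · intro x hx h1
    exact inv_mem h1

/-- The range `n ≥ 3` of the index of the direct systems below. -/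
abbrev Rank : Type := Set.Ici (3 : ℕ)

/-- The index `n = 3`. -/
def rankThree : Rank := ⟨3, le_refl 3⟩

instance : DirectedSystem (fun n : Rank => StU L n.1)
    (fun _ _ h => StU.stab L (Subtype.coe_le_coe.mpr h)) where
  map_self _ x := StU.stab_self L x
  map_map _ _ _ _ _ x := StU.stab_stab L _ _ x

instance : DirectedSystem (fun n : Rank => EU L n.1)
    (fun _ _ h => EU.stab L (Subtype.coe_le_coe.mpr h)) where
  map_self _ x := by
    obtain ⟨y, rfl⟩ := StU.toEU_surjective L _ x
    rw [← toEU_stab, StU.stab_self]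
  map_map _ _ _ _ _ x := by
    obtain ⟨y, rfl⟩ := StU.toEU_surjective L _ x
    rw [← toEU_stab, ← toEU_stab, StU.stab_stab, ← toEU_stab]

instance : DirectedSystem (fun n : Rank => K2U L n.1)
    (fun _ _ h => K2U.stab L (Subtype.coe_le_coe.mpr h)) where
  map_self _ x := Subtype.ext (StU.stab_self L x.1)
  map_map _ _ _ _ _ x := Subtype.ext (StU.stab_stab L _ _ x.1)

/-- The group `StU(R, 𝔏) = StU(∞, R, 𝔏)`, the direct limit of the groups `StU(2n, R, 𝔏)`. -/
abbrev StUInf : Type (max u v) :=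
  DirectLimit (fun n : Rank => StU L n.1) (fun _ _ h => StU.stab L (Subtype.coe_le_coe.mpr h))

/-- The group `EU(R, 𝔏)`, the direct limit of the groups `EU(2n, R, 𝔏)`. -/
abbrev EUInf : Type (max u v) :=
  DirectLimit (fun n : Rank => EU L n.1) (fun _ _ h => EU.stab L (Subtype.coe_le_coe.mpr h))

/-- The group `K₂U(R, 𝔏)`, the direct limit of the groups `K₂U(2n, R, 𝔏)`. -/
abbrev K2UInf : Type (max u v) :=
  DirectLimit (fun n : Rank => K2U L n.1) (fun _ _ h => K2U.stab L (Subtype.coe_le_coe.mpr h))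

/-- The natural homomorphism `StU(R, 𝔏) → EU(R, 𝔏)`. -/
noncomputable def StUInf.toEU : StUInf L →* EUInf L where
  toFun := DirectLimit.map _ _ (fun n : Rank => StU.toEU L n.1)
    (fun _ _ _ x => (toEU_stab L _ x).symm)
  map_one' := by
    rw [DirectLimit.one_def rankThree, DirectLimit.map_def]
    simp only [map_one]
    rw [DirectLimit.one_def rankThree]
  map_mul' := DirectLimit.induction₂ _ fun n x y => by
    simp only [DirectLimit.mul_def, DirectLimit.map_def, map_mul]

/-- The natural homomorphism `K₂U(R, 𝔏) → StU(R, 𝔏)`. -/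
noncomputable def K2UInf.toStU : K2UInf L →* StUInf L where
  toFun := DirectLimit.map _ _ (fun (n : Rank) (x : K2U L n.1) => x.1)
    (fun _ _ _ x => (K2U.coe_stab L _ x).symm)
  map_one' := by
    rw [DirectLimit.one_def rankThree, DirectLimit.map_def]
    rw [DirectLimit.one_def rankThree]
    rfl
  map_mul' := DirectLimit.induction₂ _ fun n x y => by
    rw [DirectLimit.mul_def, DirectLimit.map_def, DirectLimit.map_def, DirectLimit.map_def,
      DirectLimit.mul_def]
    rfl

end stable

/-! ### Central extensions and the Schur multiplier -/

section central

variable {U : Type*} {G : Type*} [Group U] [Group G]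

/-- `ε : H → G` is a central extension of `G`: an epimorphism with central kernel. -/
def IsCentralExtension {H : Type*} [Group H] (ε : H →* G) : Prop :=
  Function.Surjective ε ∧ ε.ker ≤ Subgroup.center H

/-- `π : U → G` is a universal central extension of `G`: it is a central extension, and it
factors uniquely through every central extension `ε : H → G` (`H` in an arbitrary universe `w`). -/
def IsUniversalCentralExtension (π : U →* G) : Prop :=
  IsCentralExtension π ∧ ∀ (H : Type w) [Group H] (ε : H →* G), IsCentralExtension ε →
    ∃! η : U →* H, ε.comp η = π

/-- The group `K`, embedded by `i` into `U`, is the Schur multiplier of `G`: it is the kernel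
of the universal central extension `π : U → G`. -/
structure IsSchurMultiplier {K : Type*} [Group K] (i : K →* U) (π : U →* G) : Prop where
  injective : Function.Injective i
  range_eq : i.range = π.ker
  universal : IsUniversalCentralExtension.{w} π

end central

end OddUnitary

namespace OddUnitary

/-! ### Elementary generators of the Steinberg group -/

section generators

namespace Idx

variable {n : ℕ}

/-! The core is that for `n ≥ 5` every central extension `p : E → StU` splits (`exists_section`). In
a central extension the commutator of two elements depends only on their images
(`commutator_congr`), so each relation expressing a generator as a commutator picks out a canonical
lift. Using such a relation involves an auxiliary index, and the work is to show that the lift does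
not depend on it. For short generators this follows from an associativity law for iterated
commutators (`br_x_mul`, `br_x_x`). For long generators the lift is read off from `[X_i(ξ),
X_{-i,j}(b)]`, and `liftG_mul` compares two choices of `i`, at the price of a correction `liftZ`
from the relation `[X_{ij}, X_{j,-i}]`. The lemmas `br_y_y`, `liftY_add` and `liftZ_eq_liftY` supply
the remaining relations among the lifts.

To factor `StU → EU` through a central extension `H → EU`, pull the latter back to `StU`, split it
and project to `H` (`StU.exists_lift`). The factorization is unique because `StU` is perfect
(`eq_of_comp_eq`).

Centrality comes from unipotent radicals. If `|r| > m`, the image of the rank `m` group normalizes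
the subgroup generated by all `X_{rl}(a)` and `X_r(ξ)`, and this subgroup maps injectively to `EU`
by a normal form. Hence an element of the kernel in rank `m` commutes with it, and the radicals of
`r` and `-r` generate everything. In the limit every kernel element comes from a smaller rank, so
centrality is automatic. The lifts in finite rank glue by uniqueness.

For `H₂`, let `M` be the 2-chains modulo the 2-boundaries. The tautological cocycle with values in
`M` defines a central extension of `G`, and the universal property yields a map from the kernel `K`
to `M`. A factor set of `U → G` gives a map back, and together they identify `K` with cycles modulo
boundaries. -/

lemma ne_of_fst {i j : Idx n} (h : i.1 ≠ j.1) : i ≠ j := fun e => h (congrArg Prod.fst e)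

lemma ne_opp_of_fst {i j : Idx n} (h : i.1 ≠ j.1) : i ≠ j.opp :=
  fun e => h (by rw [e]; rfl)

lemma ne_opp_self (i : Idx n) : i ≠ i.opp := i.opp_ne.symm

/-- Absolute values are blind to signs, and `i.opp.1` is definitionally `i.1`, so one inequality
serves for all four sign choices. -/
lemma indep_iff {i j : Idx n} : i.Indep j ↔ i.1 ≠ j.1 := by
  refine ⟨fun h e => ?_, fun h => ⟨ne_of_fst h, ne_opp_of_fst h⟩⟩
  rcases i with ⟨i, _ | _⟩ <;> rcases j with ⟨j, _ | _⟩ <;> simp_all [Indep, opp]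

/-- The source of the bound `n ≥ 5`: up to four absolute values must be avoided at once, for two
short generators in `commute_x_x` or for two competing middle indices in `br_x_x`. -/
lemma exists_fresh (hn : 5 ≤ n) (a b c d : Fin n) :
    ∃ l : Idx n, a ≠ l.1 ∧ b ≠ l.1 ∧ c ≠ l.1 ∧ d ≠ l.1 := by
  have hc : ({a, b, c, d} : Finset (Fin n)).card < Fintype.card (Fin n) := by
    rw [Fintype.card_fin]
    exact lt_of_le_of_lt Finset.card_le_four (by omega)
  obtain ⟨l, hl⟩ := Finset.exists_mem_notMem_of_card_lt_card (s := {a, b, c, d})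
    (t := Finset.univ) hc
  refine ⟨(l, true), ?_⟩
  simpa [eq_comm] using hl

/-- An index whose absolute value differs from those of `i` and `j`. -/
noncomputable def fresh (i j : Idx n) : Idx n :=
  @Classical.epsilon _ ⟨i⟩ fun k => i.1 ≠ k.1 ∧ j.1 ≠ k.1

lemma fresh_spec (hn : 5 ≤ n) (i j : Idx n) : i.1 ≠ (fresh i j).1 ∧ j.1 ≠ (fresh i j).1 := by
  obtain ⟨l, h1, h2, -, -⟩ := exists_fresh hn i.1 j.1 i.1 i.1
  exact @Classical.epsilon_spec_aux _ ⟨i⟩ (fun k : Idx n => i.1 ≠ k.1 ∧ j.1 ≠ k.1) ⟨l, h1, h2⟩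

end Idx

variable {R : Type u} [Ring R] {J : PseudoInvolution R} {V : Type v} [AddCommGroup V]
  [Module Rᵐᵒᵖ V] {B : AntiHermitianForm J V} (L : OddFormParameter B) {n : ℕ}

open Classical in
/-- The element `X_{ij}(a)` of the Steinberg group, understood as `1` for `i = ±j`. -/
noncomputable def StU.x (i j : Idx n) (a : R) : StU L n :=
  if h : i.Indep j then PresentedGroup.of (.short i j h a) else 1

/-- The element `X_i(ξ)` of the Steinberg group. -/
def StU.y (i : Idx n) (ξ : L.toAddSubgroup) : StU L n := PresentedGroup.of (.long i ξ)

lemma StU.mk_eq_one {r : FreeGroup (Gen L n)} (hr : Relator L n r) :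
    PresentedGroup.mk {r | Relator L n r} r = 1 :=
  PresentedGroup.one_of_mem hr

lemma StU.mk_X (i j : Idx n) (h : i.Indep j) (a : R) :
    PresentedGroup.mk {r | Relator L n r} (OddUnitary.X L i j h a) = StU.x L i j a := by
  simp only [StU.x, dif_pos h]
  rfl

lemma StU.mk_Y (i : Idx n) (ξ : L.toAddSubgroup) :
    PresentedGroup.mk {r | Relator L n r} (OddUnitary.Y i ξ) = StU.y L i ξ := rfl

lemma StU.x_of_indep {i j : Idx n} (h : i.Indep j) (a : R) :
    StU.x L i j a = PresentedGroup.of (.short i j h a) := dif_pos h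

lemma StU.x_eq_one {i j : Idx n} (h : i.1 = j.1) (a : R) : StU.x L i j a = 1 :=
  dif_neg fun e => Idx.indep_iff.mp e h

lemma StU.x_opp (i j : Idx n) (a : R) :
    StU.x L i j a = StU.x L j.opp i.opp (eps J j.opp * J.bar a * eps J i) := by
  by_cases h : i.1 = j.1
  · rw [StU.x_eq_one L h, StU.x_eq_one L (show j.opp.1 = i.opp.1 from h.symm)]
  · have h1 : i.Indep j := Idx.indep_iff.mpr h
    have h2 : j.opp.Indep i.opp := Idx.indep_iff.mpr (Ne.symm h)
    have := StU.mk_eq_one L (.r0 i j h1 h2 a)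
    rwa [map_mul, map_inv, mul_inv_eq_one, StU.mk_X, StU.mk_X] at this

lemma StU.x_add (i j : Idx n) (a b : R) :
    StU.x L i j (a + b) = StU.x L i j a * StU.x L i j b := by
  by_cases h : i.1 = j.1
  · simp [StU.x_eq_one L h]
  · have := StU.mk_eq_one L (.r1 i j (Idx.indep_iff.mpr h) a b)
    rw [map_mul, map_mul, map_inv, mul_inv_eq_one, StU.mk_X, StU.mk_X, StU.mk_X] at this
    exact this.symm

lemma StU.x_zero (i j : Idx n) : StU.x L i j 0 = 1 := by
  simpa using StU.x_add L i j 0 0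

lemma StU.x_neg (i j : Idx n) (a : R) : StU.x L i j (-a) = (StU.x L i j a)⁻¹ := by
  rw [eq_inv_iff_mul_eq_one, ← StU.x_add, neg_add_cancel, StU.x_zero]

lemma StU.y_add (i : Idx n) (ξ ζ : L.toAddSubgroup) :
    StU.y L i (ξ + ζ) = StU.y L i ξ * StU.y L i ζ := by
  have := StU.mk_eq_one L (.r2 i ξ ζ)
  rw [map_mul, map_mul, map_inv, mul_inv_eq_one, StU.mk_Y, StU.mk_Y, StU.mk_Y] at this
  exact this.symm

lemma StU.commute_x_x {i j h k : Idx n} (h1 : h ≠ j) (h2 : h ≠ i.opp) (h3 : k ≠ i)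
    (h4 : k ≠ j.opp) (a b : R) : Commute (StU.x L i j a) (StU.x L h k b) := by
  by_cases hij : i.1 = j.1
  · rw [StU.x_eq_one L hij]; exact Commute.one_left _
  by_cases hhk : h.1 = k.1
  · rw [StU.x_eq_one L hhk]; exact Commute.one_right _
  have := StU.mk_eq_one L (.r3 i j h k (Idx.indep_iff.mpr hij) (Idx.indep_iff.mpr hhk) h1 h2 h3
    h4 a b)
  rwa [map_commutatorElement, StU.mk_X, StU.mk_X, commutatorElement_eq_one_iff_commute] at this

lemma StU.commute_y_x {i j k : Idx n} (h1 : j ≠ i.opp) (h2 : k ≠ i) (ξ : L.toAddSubgroup)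
    (a : R) : Commute (StU.y L i ξ) (StU.x L j k a) := by
  by_cases hjk : j.1 = k.1
  · rw [StU.x_eq_one L hjk]; exact Commute.one_right _
  have := StU.mk_eq_one L (.r4 i j k (Idx.indep_iff.mpr hjk) h1 h2 ξ a)
  rwa [map_commutatorElement, StU.mk_X, StU.mk_Y, commutatorElement_eq_one_iff_commute] at this

lemma StU.comm_x_x {i j k : Idx n} (hij : i.1 ≠ j.1) (hjk : j.1 ≠ k.1) (hik : i.1 ≠ k.1)
    (a b : R) : ⁅StU.x L i j a, StU.x L j k b⁆ = StU.x L i k (a * b) := by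
  have := StU.mk_eq_one L (.r5 i j k (Idx.indep_iff.mpr hij) (Idx.indep_iff.mpr hjk)
    (Idx.indep_iff.mpr hik) a b)
  rwa [map_mul, map_inv, map_commutatorElement, mul_inv_eq_one, StU.mk_X, StU.mk_X,
    StU.mk_X] at this

lemma StU.comm_y_y {i j : Idx n} (hij : i.1 ≠ j.1) (ξ ζ : L.toAddSubgroup) :
    ⁅StU.y L i ξ, StU.y L j ζ⁆ = StU.x L i j.opp (eps J i * B ξ.1.vec ζ.1.vec) := by
  have := StU.mk_eq_one L (.r6 i j (Idx.indep_iff.mpr hij) (Idx.indep_iff.mpr hij) ξ ζ)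
  rwa [map_mul, map_inv, map_commutatorElement, mul_inv_eq_one, StU.mk_X, StU.mk_Y,
    StU.mk_Y] at this

lemma StU.comm_y_x {i j : Idx n} (hij : i.1 ≠ j.1) (ξ : L.toAddSubgroup) (b : R) :
    ⁅StU.y L i ξ, StU.x L i.opp j b⁆ =
      StU.x L i j (eps J i * ξ.1.scal * b) * StU.y L j.opp (L.conjAct ξ b) := by
  have := StU.mk_eq_one L (.r8 i j (Idx.indep_iff.mpr hij) (Idx.indep_iff.mpr hij) ξ b)
  rwa [map_mul, map_inv, map_mul, map_commutatorElement, mul_inv_eq_one, StU.mk_X, StU.mk_X,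
    StU.mk_Y, StU.mk_Y] at this

lemma StU.comm_x_x_opp {i j : Idx n} (hij : i.1 ≠ j.1) (a b : R) :
    ⁅StU.x L i j a, StU.x L j i.opp b⁆ = StU.y L i (shortParam L i a b) := by
  have := StU.mk_eq_one L (.r9 i j (Idx.indep_iff.mpr hij)
    (Idx.indep_iff.mpr (show j.1 ≠ i.opp.1 from hij.symm)) a b)
  rwa [map_mul, map_inv, map_commutatorElement, mul_inv_eq_one, StU.mk_X, StU.mk_X,
    StU.mk_Y] at this

lemma OddFormParameter.ext_val {ξ ζ : L.toAddSubgroup} (h1 : ξ.1.vec = ζ.1.vec)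
    (h2 : ξ.1.scal = ζ.1.scal) : ξ = ζ :=
  Subtype.ext (Heisenberg.ext h1 h2)

@[simp] lemma OddFormParameter.conjAct_vec (ξ : L.toAddSubgroup) (b : R) :
    (L.conjAct ξ b).1.vec = ξ.1.vec <• b := rfl

@[simp] lemma OddFormParameter.conjAct_scal (ξ : L.toAddSubgroup) (b : R) :
    (L.conjAct ξ b).1.scal = -(J.bar b * J.inv * J.bar ξ.1.scal * b) := by
  simp [OddFormParameter.conjAct, Heisenberg.act]

/-- Since `(u, a) ↦ (u, -ā)` is an involution, the relation for `[X_i(ξ), X_{-i,j}(1)]` reaches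
every long generator. -/
lemma OddFormParameter.conjAct_conjAct_one (ξ : L.toAddSubgroup) :
    L.conjAct (L.conjAct ξ 1) 1 = ξ := by
  apply OddFormParameter.ext_val
  · simp
  · simp [J.bar_one_mul_inv, J.bar_bar]

/-- The order is reversed because `-(B(u, v))‾ = B(v, u)`. -/
lemma OddFormParameter.conjAct_add_one (ξ ζ : L.toAddSubgroup) :
    L.conjAct (ξ + ζ) 1 = L.conjAct ζ 1 + L.conjAct ξ 1 := by
  apply OddFormParameter.ext_val
  · simp [add_comm]
  · have := B.neg_bar ζ.1.vec ξ.1.vec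
    simp [J.bar_one_mul_inv, this]
    abel

/-- The subgroup generated by all generators is everything. -/
lemma StU.eq_top_of_mem {K : Subgroup (StU L n)} (hx : ∀ i j, i.1 ≠ j.1 → ∀ a, StU.x L i j a ∈ K)
    (hy : ∀ i ξ, StU.y L i ξ ∈ K) : K = ⊤ := by
  rw [eq_top_iff, ← PresentedGroup.closure_range_of, Subgroup.closure_le]
  rintro _ ⟨g, rfl⟩
  cases g with
  | short i j h a =>
    have := hx i j (Idx.indep_iff.mp h) a
    rwa [StU.x_of_indep L h] at this
  | long i ξ => exact hy i ξ

/-- Solves the relation for `[X_k, X_{-k,-j}]` for its long factor. It yields perfectness and the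
generation of the group by two opposite radicals. -/
lemma StU.y_eq {k j : Idx n} (h : k.1 ≠ j.1) (ξ : L.toAddSubgroup) :
    StU.y L j ξ = (StU.x L k j.opp (eps J k * (L.conjAct ξ 1).1.scal))⁻¹ *
      ⁅StU.y L k (L.conjAct ξ 1), StU.x L k.opp j.opp 1⁆ := by
  rw [StU.comm_y_x L (show k.1 ≠ j.opp.1 from h), L.conjAct_conjAct_one, Idx.opp_opp, mul_one,
    inv_mul_cancel_left]

end generators

/-! ### Commutators in central extensions -/

section commutators

/-- Conjugation by `x` fixes `z` and sends `y` to `[x, y] y`, so it sends `[y, z]` to `[[x, y] y,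
z]`; expand the product. -/
lemma commutator_commutator_of_commute {G : Type*} [Group G] {x y z : G} (h : Commute x z) :
    ⁅x, ⁅y, z⁆⁆ = ⁅x, y⁆ * ⁅y, z⁆ * ⁅x, y⁆⁻¹ * ⁅⁅x, y⁆, z⁆ * ⁅y, z⁆⁻¹ := by
  have hz : x * z * x⁻¹ = z := by rw [h.eq, mul_inv_cancel_right]
  have hz' : x * z⁻¹ * x⁻¹ = z⁻¹ := by rw [h.inv_right.eq, mul_inv_cancel_right]
  calc ⁅x, ⁅y, z⁆⁆ = (x * y * x⁻¹) * (x * z * x⁻¹) * (x * y⁻¹ * x⁻¹) * (x * z⁻¹ * x⁻¹) *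
        ⁅y, z⁆⁻¹ := by simp only [commutatorElement_def]; group
    _ = _ := by
      rw [hz, hz']
      simp only [commutatorElement_def]; group

/-- The associativity law that moves a coefficient across a commutator and so changes its middle
index. -/
lemma commutator_commutator_comm {G : Type*} [Group G] {x y z : G} (h : Commute x z)
    (h1 : Commute ⁅x, y⁆ ⁅y, z⁆) (h2 : Commute ⁅y, z⁆ ⁅⁅x, y⁆, z⁆) :
    ⁅x, ⁅y, z⁆⁆ = ⁅⁅x, y⁆, z⁆ := by
  rw [commutator_commutator_of_commute h, h1.eq, mul_inv_cancel_right, h2.eq,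
    mul_inv_cancel_right]

lemma commutator_mul_left {G : Type*} [Group G] (x y z : G) :
    ⁅x * y, z⁆ = x * ⁅y, z⁆ * x⁻¹ * ⁅x, z⁆ := by
  simp only [commutatorElement_def]; group

lemma commutator_mul_right {G : Type*} [Group G] (x y z : G) :
    ⁅x, y * z⁆ = ⁅x, y⁆ * (y * ⁅x, z⁆ * y⁻¹) := by
  simp only [commutatorElement_def]; group

namespace IsCentralExtension

variable {E S : Type*} [Group E] [Group S] {p : E →* S}

/-- A preimage of `x` under a central extension. -/
noncomputable def lift (h : IsCentralExtension p) (x : S) : E := Function.surjInv h.1 x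

@[simp] lemma map_lift (h : IsCentralExtension p) (x : S) : p (h.lift x) = x := Function.surjInv_eq h.1 x

/-- The commutator of lifts of `x` and `y`; it does not depend on the choice of the lifts. -/
noncomputable def br (h : IsCentralExtension p) (x y : S) : E := ⁅h.lift x, h.lift y⁆

@[simp] lemma map_br (h : IsCentralExtension p) (x y : S) : p (h.br x y) = ⁅x, y⁆ := by simp [br]

lemma exists_central_of_eq (h : p.ker ≤ Subgroup.center E) {a b : E} (hab : p a = p b) : ∃ z ∈ Subgroup.center E, a = z * b :=
  ⟨a * b⁻¹, h (by simp [MonoidHom.mem_ker, hab]), by simp⟩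

/-- Two preimages of one element differ by a central factor, which drops out of commutators.
Everything about `br` rests on this. -/
lemma commutator_congr (h : p.ker ≤ Subgroup.center E) {a a' b b' : E} (ha : p a = p a') (hb : p b = p b') :
    ⁅a, b⁆ = ⁅a', b'⁆ := by
  obtain ⟨z, hz, rfl⟩ := exists_central_of_eq h ha
  obtain ⟨w, hw, rfl⟩ := exists_central_of_eq h hb
  rw [Subgroup.mem_center_iff] at hz hw
  have hz' : ∀ g, Commute g z := hz
  have hw' : ∀ g, Commute g w := hw
  rw [commutator_mul_left, commutator_mul_right, commutatorElement_eq_one_iff_commute.mpr (hw' a'),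
    commutatorElement_eq_one_iff_commute.mpr (hz' _).symm, one_mul, mul_one,
    (hw' _).symm.eq, mul_inv_cancel_right, (hz' _).symm.eq, mul_inv_cancel_right]

lemma commutator_eq_br (h : IsCentralExtension p) (a b : E) : ⁅a, b⁆ = h.br (p a) (p b) :=
  commutator_congr h.2 (by simp) (by simp)

lemma commute_of_map_eq_one (h : IsCentralExtension p) {a b : E} (hb : p b = 1) : Commute a b :=
  Subgroup.mem_center_iff.mp (h.2 hb) a

/-- Conjugation by `a` changes `b` and `c` only by central factors, hence fixes their commutator. -/
lemma commute_commutator (h : IsCentralExtension p) {a b c : E} (hb : Commute (p a) (p b)) (hc : Commute (p a) (p c)) :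
    Commute a ⁅b, c⁆ := by
  have hb' : p (a * b * a⁻¹) = p b := by simp [hb.eq]
  have hc' : p (a * c * a⁻¹) = p c := by simp [hc.eq]
  have : a * ⁅b, c⁆ * a⁻¹ = ⁅b, c⁆ := by
    refine Eq.trans ?_ (commutator_congr h.2 hb' hc')
    simp only [commutatorElement_def]; group
  exact mul_inv_eq_iff_eq_mul.mp this

lemma commute_of_eq_commutator (h : IsCentralExtension p) {a b : E} {y z : S} (hb : p b = ⁅y, z⁆) (hy : Commute (p a) y)
    (hz : Commute (p a) z) : Commute a b := by
  obtain ⟨w, hw, rfl⟩ := exists_central_of_eq h.2 (hb.trans (h.map_br y z).symm)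
  refine Commute.mul_right (Subgroup.mem_center_iff.mp hw a) ?_
  exact h.commute_commutator (by simpa using hy) (by simpa using hz)

lemma commute_of_commute_commutator (h : IsCentralExtension p) {a b : E} {x y z : S} (ha : p a = x) (hb : p b = ⁅y, z⁆)
    (hy : Commute x y) (hz : Commute x z) : Commute a b :=
  h.commute_of_eq_commutator hb (ha ▸ hy) (ha ▸ hz)

end IsCentralExtension

end commutators

/-! ### Canonical lifts of the short elementary generators -/

namespace IsCentralExtension

variable {R : Type u} [Ring R] {J : PseudoInvolution R} {V : Type v} [AddCommGroup V]
  [Module Rᵐᵒᵖ V] {B : AntiHermitianForm J V} {L : OddFormParameter B} {n : ℕ}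
  {E : Type*} [Group E] {p : E →* StU L n}

open Idx in
-- With `m` fresh, `X_{kl}(s) = [X_{km}(1), X_{ml}(s)]`, and both factors commute with `X_{ij}(r)`
-- already in `StU`; so commutation lifts to `E`.
lemma commute_x_x (h : IsCentralExtension p) (hn : 5 ≤ n) {i j k l : Idx n} (h1 : k ≠ j)
    (h2 : k ≠ i.opp) (h3 : l ≠ i) (h4 : l ≠ j.opp) {a b : E} {r s : R}
    (ha : p a = StU.x L i j r) (hb : p b = StU.x L k l s) : Commute a b := by
  by_cases hkl : k.1 = l.1
  · rw [StU.x_eq_one L hkl] at hb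
    exact h.commute_of_map_eq_one hb
  obtain ⟨m, m1, m2, m3, m4⟩ := exists_fresh hn i.1 j.1 k.1 l.1
  rw [← one_mul s, ← StU.comm_x_x L (j := m) m3 m4.symm hkl] at hb
  exact h.commute_of_commute_commutator ha hb
    (StU.commute_x_x L h1 h2 (ne_of_fst m1.symm) (ne_opp_of_fst m2.symm) _ _)
    (StU.commute_x_x L (ne_of_fst m2.symm) (ne_opp_of_fst m1.symm) h3 h4 _ _)

open Idx in
lemma commute_y_x (h : IsCentralExtension p) (hn : 5 ≤ n) {i j k : Idx n} (h1 : j ≠ i.opp)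
    (h2 : k ≠ i) {a b : E} {ξ : L.toAddSubgroup} {r : R}
    (ha : p a = StU.y L i ξ) (hb : p b = StU.x L j k r) : Commute a b := by
  by_cases hjk : j.1 = k.1
  · rw [StU.x_eq_one L hjk] at hb
    exact h.commute_of_map_eq_one hb
  obtain ⟨m, m1, m2, m3, -⟩ := exists_fresh hn i.1 j.1 k.1 k.1
  rw [← one_mul r, ← StU.comm_x_x L (j := m) m2 m3.symm hjk] at hb
  exact h.commute_of_commute_commutator ha hb
    (StU.commute_y_x L h1 (ne_of_fst m1.symm) _ _)
    (StU.commute_y_x L (ne_opp_of_fst m1.symm) h2 _ _)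

open Idx in
-- Both sides are iterated commutators of lifts of `X_{ik}(a)`, `X_{kl}(b)`, `X_{lj}(c)`, bracketed
-- in the two possible ways.
lemma br_x_mul (h : IsCentralExtension p) (hn : 5 ≤ n) {i j k l : Idx n} (hij : i.1 ≠ j.1)
    (hik : i.1 ≠ k.1) (hil : i.1 ≠ l.1) (hjk : j.1 ≠ k.1) (hjl : j.1 ≠ l.1) (hkl : k.1 ≠ l.1)
    (a b c : R) :
    h.br (StU.x L i k a) (StU.x L k j (b * c)) = h.br (StU.x L i l (a * b)) (StU.x L l j c) := by
  have e1 := h.commutator_eq_br (h.lift (StU.x L i k a))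
    ⁅h.lift (StU.x L k l b), h.lift (StU.x L l j c)⁆
  have e2 := h.commutator_eq_br ⁅h.lift (StU.x L i k a), h.lift (StU.x L k l b)⁆
    (h.lift (StU.x L l j c))
  have p1 : p ⁅h.lift (StU.x L i k a), h.lift (StU.x L k l b)⁆ = StU.x L i l (a * b) := by
    simp [StU.comm_x_x L hik hkl hil]
  have p2 : p ⁅h.lift (StU.x L k l b), h.lift (StU.x L l j c)⁆ = StU.x L k j (b * c) := by
    simp [StU.comm_x_x L hkl hjl.symm hjk.symm]
  have p3 : p ⁅⁅h.lift (StU.x L i k a), h.lift (StU.x L k l b)⁆, h.lift (StU.x L l j c)⁆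
      = StU.x L i j (a * b * c) := by
    rw [map_commutatorElement, p1, map_lift, StU.comm_x_x L hil hjl.symm hij]
  rw [p2, map_lift] at e1
  rw [p1, map_lift] at e2
  rw [← e1, ← e2]
  refine commutator_commutator_comm ?_ ?_ ?_
  · exact h.commute_x_x hn (ne_of_fst hkl.symm) (ne_opp_of_fst hil.symm) (ne_of_fst hij.symm)
      (ne_opp_of_fst hjk) (h.map_lift _) (h.map_lift _)
  · exact h.commute_x_x hn (ne_of_fst hkl) (ne_opp_of_fst hik.symm) (ne_of_fst hij.symm)
      (ne_opp_of_fst hjl) p1 p2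
  · exact h.commute_x_x hn (ne_of_fst hij) (ne_opp_of_fst hik) (ne_of_fst hjk)
      (ne_opp_self _) p2 p3

/-- The canonical lift of `X_{ij}(a)`. -/
noncomputable def liftX (h : IsCentralExtension p) (i j : Idx n) (a : R) : E :=
  h.br (StU.x L i (Idx.fresh i j) 1) (StU.x L (Idx.fresh i j) j a)

lemma map_liftX (h : IsCentralExtension p) (hn : 5 ≤ n) {i j : Idx n} (hij : i.1 ≠ j.1) (a : R) :
    p (h.liftX i j a) = StU.x L i j a := by
  obtain ⟨h1, h2⟩ := Idx.fresh_spec hn i j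
  rw [liftX, map_br, StU.comm_x_x L h1 h2.symm hij, one_mul]

/-- Independence of the middle index: the commutators through `j` and through the chosen index of
`liftX` are both moved to a further index `l`, with the whole coefficient on the left factor. -/
lemma br_x_x (h : IsCentralExtension p) (hn : 5 ≤ n) {i j k : Idx n} (hij : i.1 ≠ j.1)
    (hjk : j.1 ≠ k.1) (hik : i.1 ≠ k.1) (a b : R) :
    h.br (StU.x L i j a) (StU.x L j k b) = h.liftX i k (a * b) := by
  obtain ⟨f1, f2⟩ := Idx.fresh_spec hn i k
  obtain ⟨l, l1, l2, l3, l4⟩ := Idx.exists_fresh hn i.1 j.1 k.1 (Idx.fresh i k).1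
  have e1 := h.br_x_mul hn (k := j) (l := l) hik hij l1 hjk.symm l3 l2 a b 1
  have e2 := h.br_x_mul hn (k := Idx.fresh i k) (l := l) hik f1 l1 f2 l3 l4 1 (a * b) 1
  rw [mul_one] at e1 e2
  rw [e1, liftX, e2, one_mul]

lemma liftX_add (h : IsCentralExtension p) (hn : 5 ≤ n) {i j : Idx n} (hij : i.1 ≠ j.1)
    (a b : R) : h.liftX i j (a + b) = h.liftX i j a * h.liftX i j b := by
  obtain ⟨f1, f2⟩ := Idx.fresh_spec hn i j
  have e := h.commutator_eq_br (h.lift (StU.x L i (Idx.fresh i j) 1))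
    (h.lift (StU.x L (Idx.fresh i j) j a) * h.lift (StU.x L (Idx.fresh i j) j b))
  rw [map_mul, map_lift, map_lift, map_lift, ← StU.x_add, commutator_mul_right] at e
  change h.br _ _ * (_ * h.br _ _ * _) = _ at e
  have hc : Commute (h.lift (StU.x L (Idx.fresh i j) j a)) (h.liftX i j b) :=
    h.commute_x_x hn (Idx.ne_of_fst hij) (Idx.ne_opp_of_fst f1) (Idx.ne_of_fst f2)
      (Idx.ne_opp_self j) (h.map_lift _) (h.map_liftX hn hij b)
  change _ * (_ * h.liftX i j b * _) = _ at e
  rw [hc.eq, mul_inv_cancel_right] at e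
  exact e.symm

lemma liftX_zero (h : IsCentralExtension p) (hn : 5 ≤ n) {i j : Idx n} (hij : i.1 ≠ j.1) :
    h.liftX i j 0 = 1 := by
  simpa using h.liftX_add hn hij 0 0

lemma liftX_neg (h : IsCentralExtension p) (hn : 5 ≤ n) {i j : Idx n} (hij : i.1 ≠ j.1) (a : R) :
    h.liftX i j (-a) = (h.liftX i j a)⁻¹ := by
  rw [eq_inv_iff_mul_eq_one, ← h.liftX_add hn hij, neg_add_cancel, h.liftX_zero hn hij]

lemma br_inv (h : IsCentralExtension p) (x y : StU L n) : (h.br x y)⁻¹ = h.br y x :=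
  commutatorElement_inv _ _

/-- Rewriting both factors of the defining commutator swaps their order; the resulting inverse is
cancelled by the sign in `ε_k ε_{-k} = -1̄⁻¹`. -/
lemma liftX_opp (h : IsCentralExtension p) (hn : 5 ≤ n) {i j : Idx n} (hij : i.1 ≠ j.1) (a : R) :
    h.liftX i j a = h.liftX j.opp i.opp (eps J j.opp * J.bar a * eps J i) := by
  obtain ⟨f1, f2⟩ := Idx.fresh_spec hn i j
  rw [liftX]
  set k := Idx.fresh i j
  rw [StU.x_opp L i k, StU.x_opp L k j, ← h.br_inv, h.br_x_x hn (j := k.opp) (i := j.opp)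
    (k := i.opp) f2 f1.symm hij.symm, ← h.liftX_neg hn (show j.opp.1 ≠ i.opp.1 from hij.symm)]
  congr 1
  have : eps J k * (eps J k.opp * (J.bar 1 * eps J i)) = -eps J i := by
    rw [eps_mul_eps_opp_assoc, J.inv_mul_bar_one_assoc]
  simp only [mul_assoc, this, mul_neg, neg_neg]

lemma commutator_x_x (h : IsCentralExtension p) (hn : 5 ≤ n) {i j k : Idx n} (hij : i.1 ≠ j.1)
    (hjk : j.1 ≠ k.1) (hik : i.1 ≠ k.1) {a b : E} {r s : R} (ha : p a = StU.x L i j r)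
    (hb : p b = StU.x L j k s) : ⁅a, b⁆ = h.liftX i k (r * s) := by
  rw [h.commutator_eq_br, ha, hb, h.br_x_x hn hij hjk hik]

end IsCentralExtension

/-! ### Canonical lifts of the long elementary generators -/

namespace IsCentralExtension

variable {R : Type u} [Ring R] {J : PseudoInvolution R} {V : Type v} [AddCommGroup V]
  [Module Rᵐᵒᵖ V] {B : AntiHermitianForm J V} {L : OddFormParameter B} {n : ℕ}
  {E : Type*} [Group E] {p : E →* StU L n}

open Idx in
lemma br_x_x_opp_mul (h : IsCentralExtension p) (hn : 5 ≤ n) {i j k : Idx n} (hij : i.1 ≠ j.1)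
    (hik : i.1 ≠ k.1) (hjk : j.1 ≠ k.1) (a b c : R) :
    h.br (StU.x L i j a) (StU.x L j i.opp (b * c)) =
      h.br (StU.x L i k (a * b)) (StU.x L k i.opp c) := by
  have e1 := h.commutator_eq_br (h.lift (StU.x L i j a))
    ⁅h.lift (StU.x L j k b), h.lift (StU.x L k i.opp c)⁆
  have e2 := h.commutator_eq_br ⁅h.lift (StU.x L i j a), h.lift (StU.x L j k b)⁆
    (h.lift (StU.x L k i.opp c))
  have p1 : p ⁅h.lift (StU.x L i j a), h.lift (StU.x L j k b)⁆ = StU.x L i k (a * b) := by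
    simp [StU.comm_x_x L hij hjk hik]
  have p2 : p ⁅h.lift (StU.x L j k b), h.lift (StU.x L k i.opp c)⁆
      = StU.x L j i.opp (b * c) := by
    rw [map_commutatorElement, map_lift, map_lift,
      StU.comm_x_x L hjk (show k.1 ≠ i.opp.1 from hik.symm) (show j.1 ≠ i.opp.1 from hij.symm)]
  have p3 : p ⁅⁅h.lift (StU.x L i j a), h.lift (StU.x L j k b)⁆, h.lift (StU.x L k i.opp c)⁆
      = StU.y L i (shortParam L i (a * b) c) := by
    rw [map_commutatorElement, p1, map_lift, StU.comm_x_x_opp L hik]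
  rw [p2, map_lift] at e1
  rw [p1, map_lift] at e2
  rw [← e1, ← e2]
  refine commutator_commutator_comm ?_ ?_ ?_
  · exact h.commute_x_x hn (ne_of_fst hjk.symm) (ne_opp_of_fst hik.symm) (opp_ne i)
      (by rw [Ne, opp_inj]; exact ne_of_fst hij) (h.map_lift _) (h.map_lift _)
  · exact h.commute_x_x hn (ne_of_fst hjk) (ne_opp_of_fst hij.symm) (opp_ne i)
      (by rw [Ne, opp_inj]; exact ne_of_fst hik) p1 p2
  · exact (h.commute_y_x hn (ne_opp_of_fst hij.symm) (opp_ne i) p3 p2).symm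

/-- The canonical lift of `X_i(0, -ε_{-i} 1̄ a + ā ε_i)`. -/
noncomputable def liftZ (h : IsCentralExtension p) (i : Idx n) (a : R) : E :=
  h.br (StU.x L i (Idx.fresh i i) 1) (StU.x L (Idx.fresh i i) i.opp a)

lemma map_liftZ (h : IsCentralExtension p) (hn : 5 ≤ n) (i : Idx n) (a : R) :
    p (h.liftZ i a) = StU.y L i (shortParam L i 1 a) := by
  obtain ⟨h1, -⟩ := Idx.fresh_spec hn i i
  rw [liftZ, map_br, StU.comm_x_x_opp L h1]

lemma br_x_x_opp (h : IsCentralExtension p) (hn : 5 ≤ n) {i j : Idx n} (hij : i.1 ≠ j.1)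
    (a b : R) : h.br (StU.x L i j a) (StU.x L j i.opp b) = h.liftZ i (a * b) := by
  obtain ⟨f1, f2⟩ := Idx.fresh_spec hn i i
  obtain ⟨l, l1, l2, l3, -⟩ := Idx.exists_fresh hn i.1 j.1 (Idx.fresh i i).1 i.1
  have e1 := h.br_x_x_opp_mul hn hij l1 l2 a b 1
  have e2 := h.br_x_x_opp_mul hn f1 l1 l3 1 (a * b) 1
  rw [mul_one] at e1 e2
  rw [e1, liftZ, e2, one_mul]

/-- The lift of `X_j((u, -ā) ↼ b)`, `ξ = (u, a)`, obtained from
`[X_i(ξ), X_{-i,-j}(b)] = X_{i,-j}(ε_i a b) X_j((u, -ā) ↼ b)`. -/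
noncomputable def liftG (h : IsCentralExtension p) (i j : Idx n) (ξ : L.toAddSubgroup) (b : R) :
    E :=
  (h.liftX i j.opp (eps J i * ξ.1.scal * b))⁻¹ * h.br (StU.y L i ξ) (StU.x L i.opp j.opp b)

lemma br_y_x_eq_liftG (h : IsCentralExtension p) (i j : Idx n) (ξ : L.toAddSubgroup) (b : R) :
    h.br (StU.y L i ξ) (StU.x L i.opp j.opp b) =
      h.liftX i j.opp (eps J i * ξ.1.scal * b) * h.liftG i j ξ b := by
  rw [liftG, mul_inv_cancel_left]

lemma map_liftG (h : IsCentralExtension p) (hn : 5 ≤ n) {i j : Idx n} (hij : i.1 ≠ j.1)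
    (ξ : L.toAddSubgroup) (b : R) : p (h.liftG i j ξ b) = StU.y L j (L.conjAct ξ b) := by
  rw [liftG, map_mul, map_inv, map_br, h.map_liftX hn (show i.1 ≠ j.opp.1 from hij),
    StU.comm_y_x L (show i.1 ≠ j.opp.1 from hij), inv_mul_cancel_left, Idx.opp_opp]

open Idx in
-- Passes from the auxiliary index `i` to `k` by evaluating `[X, [Y, Z]]` for lifts of `X_i(ξ)`,
-- `X_{-i,-k}(b)`, `X_{-k,-j}(c)` in two ways. The correction is needed because acting by `b` and
-- then by `c` applies `a ↦ -ā` twice, while acting by `bc` applies it once.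
lemma liftG_mul (h : IsCentralExtension p) (hn : 5 ≤ n) {i j k : Idx n} (hij : i.1 ≠ j.1)
    (hik : i.1 ≠ k.1) (hkj : k.1 ≠ j.1) (ξ : L.toAddSubgroup) (b c : R) :
    h.liftG i j ξ (b * c) = h.liftG k j (L.conjAct ξ b) c *
      h.liftZ j (-(eps J j * (J.bar (b * c) * J.inv * J.bar ξ.1.scal * (b * c)))) := by
  have oik : i.1 ≠ k.opp.1 := hik
  have okj : k.1 ≠ j.opp.1 := hkj
  have oij : i.1 ≠ j.opp.1 := hij
  have oikj : k.opp.1 ≠ j.opp.1 := hkj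
  have oiij : i.opp.1 ≠ j.opp.1 := hij
  have oiik : i.opp.1 ≠ k.opp.1 := hik
  set X := h.lift (StU.y L i ξ)
  set Y := h.lift (StU.x L i.opp k.opp b)
  set Z := h.lift (StU.x L k.opp j.opp c)
  set P := h.liftX i k.opp (eps J i * ξ.1.scal * b)
  set Q := h.liftG i k ξ b
  set M := h.liftX k j.opp (eps J k * (J.bar b * J.inv * J.bar ξ.1.scal) * (b * c))
  set N := h.liftX i j.opp (eps J i * ξ.1.scal * (b * c))
  set W := h.liftX i.opp j.opp (b * c)
  set G' := h.liftG k j (L.conjAct ξ b) c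
  have hpP : p P = StU.x L i k.opp (eps J i * ξ.1.scal * b) := h.map_liftX hn oik _
  have hpM : p M = StU.x L k j.opp _ := h.map_liftX hn okj _
  have hpN : p N = StU.x L i j.opp _ := h.map_liftX hn oij _
  have hpW : p W = StU.x L i.opp j.opp (b * c) := h.map_liftX hn oiij _
  have hpQ : p Q = StU.y L k (L.conjAct ξ b) := h.map_liftG hn hik _ _
  have hpG' : p G' = StU.y L j _ := h.map_liftG hn hkj _ _
  have hXY : ⁅X, Y⁆ = P * Q := h.br_y_x_eq_liftG i k ξ b
  have hYZ : ⁅Y, Z⁆ = W := h.commutator_x_x hn oiik oikj oiij (h.map_lift _) (h.map_lift _)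
  have hXW : ⁅X, W⁆ = N * h.liftG i j ξ (b * c) := by
    rw [h.commutator_eq_br, map_lift, hpW, h.br_y_x_eq_liftG]
  have hscal : eps J k * J.bar (eps J i * ξ.1.scal * b) * eps J i =
      eps J k * (J.bar b * J.inv * J.bar ξ.1.scal) := by
    simp only [J.bar_mul', mul_assoc, bar_mul_eps, J.inv_mul_bar_one, mul_one]
  have hPW : ⁅P, W⁆ = M := by
    rw [StU.x_opp, opp_opp, hscal] at hpP
    exact h.commutator_x_x hn (j := i.opp) hik.symm oiij okj hpP hpW
  have hQZ : ⁅Q, Z⁆ = M⁻¹ * G' := by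
    rw [h.commutator_eq_br, map_lift, hpQ, h.br_y_x_eq_liftG, ← h.liftX_neg hn okj]
    congr 2
    simp [mul_assoc]
  have hPZ : ⁅P, Z⁆ = N := by
    rw [h.commutator_x_x hn oik oikj oij hpP (h.map_lift _), mul_assoc]
  have cXZ : Commute X Z :=
    h.commute_y_x hn (by rw [Ne, opp_inj]; exact ne_of_fst hik.symm)
      (ne_opp_of_fst hij).symm (h.map_lift _) (h.map_lift _)
  have cQW : Commute Q W :=
    h.commute_y_x hn (by rw [Ne, opp_inj]; exact ne_of_fst hik)
      (ne_opp_of_fst hkj).symm hpQ hpW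
  have cPM : Commute P M :=
    h.commute_x_x hn (ne_opp_self k) (ne_opp_of_fst hik.symm)
      (ne_opp_of_fst hij).symm (by rw [opp_opp]; exact (ne_opp_of_fst hkj).symm) hpP hpM
  have cPG : Commute G' P :=
    h.commute_y_x hn (ne_opp_of_fst hij) (ne_opp_of_fst hkj.symm).symm hpG' hpP
  have cMW : Commute M W :=
    h.commute_x_x hn (by rw [Ne, opp_inj]; exact ne_of_fst hij)
      (by rw [Ne, opp_inj]; exact ne_of_fst hik)
      (ne_opp_of_fst hkj).symm (by rw [opp_opp]; exact opp_ne j) hpM hpW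
  have cGW : Commute G' W :=
    h.commute_y_x hn (by rw [Ne, opp_inj]; exact ne_of_fst hij) (opp_ne j) hpG' hpW
  have cGN : Commute G' N := h.commute_y_x hn (ne_opp_of_fst hij) (opp_ne j) hpG' hpN
  -- Read as a generator with indices `(j, -i)`, the first entry turns this into a commutator of
  -- type `[X_{j,-i}, X_{-i,-j}]`, which `br_x_x_opp` evaluates.
  have hNW : ⁅N⁻¹, W⁆ =
      h.liftZ j (-(eps J j * (J.bar (b * c) * J.inv * J.bar ξ.1.scal * (b * c)))) := by
    rw [h.commutator_eq_br, map_inv, hpN, hpW, ← StU.x_neg, StU.x_opp, opp_opp,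
      h.br_x_x_opp hn (j := i.opp) hij.symm]
    congr 1
    have e : J.bar (eps J i * ξ.1.scal * (b * c)) * eps J i =
        J.bar (b * c) * J.inv * J.bar ξ.1.scal := by
      rw [J.bar_mul' _ (b * c), J.bar_mul' (eps J i)]
      simp only [mul_assoc, bar_mul_eps, J.inv_mul_bar_one, mul_one]
    rw [map_neg, mul_neg, neg_mul, neg_mul, mul_assoc (eps J j), e]
    simp only [mul_assoc]
  -- The right side becomes `M W (M⁻¹ G' N) W⁻¹`: conjugation by `P Q` turns `W` into `M W`, and `[P
  -- Q, Z] = M⁻¹ G' N`. Then `M` cancels.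
  have main := commutator_commutator_of_commute (y := Y) cXZ
  rw [hYZ, hXW, hXY, commutator_mul_left, hQZ, hPZ] at main
  have e1 : P * Q * W * (P * Q)⁻¹ = M * W := by
    rw [mul_assoc P Q W, cQW.eq, ← hPW, commutatorElement_def]; group
  have e2 : P * (M⁻¹ * G') * P⁻¹ = M⁻¹ * G' := by
    rw [(cPM.inv_right.mul_right cPG.symm).eq, mul_inv_cancel_right]
  rw [e1, e2] at main
  rw [← hNW, eq_comm, ← mul_right_inj N, main, cMW.eq, commutatorElement_def]
  calc N * (G' * (N⁻¹ * W * N⁻¹⁻¹ * W⁻¹)) = (N * G') * N⁻¹ * W * N * W⁻¹ := by group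
    _ = (G' * W) * N * W⁻¹ := by rw [← cGN.eq]; group
    _ = _ := by rw [cGW.eq]; group

/-- The canonical lift of `X_j(ξ)`. -/
noncomputable def liftY (h : IsCentralExtension p) (j : Idx n) (ξ : L.toAddSubgroup) : E :=
  h.liftG (Idx.fresh j j) j (L.conjAct ξ 1) 1

lemma map_liftY (h : IsCentralExtension p) (hn : 5 ≤ n) (j : Idx n) (ξ : L.toAddSubgroup) :
    p (h.liftY j ξ) = StU.y L j ξ := by
  obtain ⟨f1, -⟩ := Idx.fresh_spec hn j j
  rw [liftY, h.map_liftG hn f1.symm, L.conjAct_conjAct_one]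

/-- `liftG_mul` with `c = 1` moves both this lift and the one defining `liftY` to a common index
`l`. The two corrections agree, since they depend only on the parameter of the long generator. -/
lemma liftG_eq_liftY (h : IsCentralExtension p) (hn : 5 ≤ n) {i j : Idx n} (hij : i.1 ≠ j.1)
    (ξ : L.toAddSubgroup) (b : R) : h.liftG i j ξ b = h.liftY j (L.conjAct ξ b) := by
  obtain ⟨f1, -⟩ := Idx.fresh_spec hn j j
  obtain ⟨l, l1, l2, l3, -⟩ := Idx.exists_fresh hn i.1 j.1 (Idx.fresh j j).1 i.1
  have e1 := h.liftG_mul hn hij l1 l2.symm ξ b 1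
  have e2 := h.liftG_mul hn f1.symm l3 l2.symm (L.conjAct (L.conjAct ξ b) 1) 1 1
  rw [mul_one] at e1 e2
  rw [e1, liftY, e2, L.conjAct_conjAct_one]
  simp [J.bar_one_mul_inv, J.bar_bar]

lemma br_y_x (h : IsCentralExtension p) (hn : 5 ≤ n) {i j : Idx n} (hij : i.1 ≠ j.1)
    (ξ : L.toAddSubgroup) (b : R) :
    h.br (StU.y L i ξ) (StU.x L i.opp j b) =
      h.liftX i j (eps J i * ξ.1.scal * b) * h.liftY j.opp (L.conjAct ξ b) := by
  have e := h.br_y_x_eq_liftG i j.opp ξ b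
  rwa [h.liftG_eq_liftY hn (show i.1 ≠ j.opp.1 from hij), Idx.opp_opp] at e

end IsCentralExtension

/-! ### Remaining relations among the lifts, and the splitting -/

/-- Follow `z` under conjugation by `y⁻¹`, `x⁻¹`, `y`, `x` in turn. The only pair whose commutator
is left unspecified is `v`, `w`, whence the last factor. -/
lemma commutator_commutator_eq {G : Type*} [Group G] {x y z v w s t : G} (hxz : ⁅x, z⁆ = w)
    (hyz : ⁅y, z⁆ = v) (hxv : ⁅x, v⁆ = s) (hyw : ⁅y, w⁆ = t) (hxw : Commute x w)
    (hyv : Commute y v) (hxs : Commute x s) (hxt : Commute x t) (hys : Commute y s)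
    (hvs : Commute v s) (hws : Commute w s) (hvt : Commute v t) (hwt : Commute w t) :
    ⁅⁅x, y⁆, z⁆ = t⁻¹ * s * ⁅v⁻¹, w⁻¹⁆ := by
  have conj : ∀ {a b c : G}, ⁅a, b⁆ = c → MulAut.conj a b = c * b := by
    rintro a b _ rfl
    simp [commutatorElement_def]
  have fix : ∀ {a b : G}, Commute a b → MulAut.conj a b = b := fun hab => by
    simp [hab.eq]
  have e1 : MulAut.conj y⁻¹ z = v⁻¹ * z := by
    rw [map_inv, MulAut.inv_apply, MulEquiv.symm_apply_eq, map_mul, map_inv, fix hyv, conj hyz,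
      inv_mul_cancel_left]
  have e2 : MulAut.conj x⁻¹ (v⁻¹ * z) = v⁻¹ * s * w⁻¹ * z := by
    rw [map_inv, MulAut.inv_apply, MulEquiv.symm_apply_eq]
    simp only [map_mul, map_inv, fix hxw, fix hxs, conj hxv, conj hxz]
    simp only [mul_inv_rev, mul_assoc, inv_mul_cancel_left]
  have e3 : MulAut.conj y (v⁻¹ * s * w⁻¹ * z) = v⁻¹ * s * (t * w)⁻¹ * (v * z) := by
    simp only [map_mul, map_inv, fix hyv, fix hys, conj hyw, conj hyz]
  have e4 : MulAut.conj x (v⁻¹ * s * (t * w)⁻¹ * (v * z)) =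
      (s * v)⁻¹ * s * (t * w)⁻¹ * (s * v * (w * z)) := by
    simp only [map_mul, map_inv, fix hxw, fix hxs, fix hxt, conj hxv, conj hxz]
  have e5 : MulAut.conj ⁅x, y⁆ z = (s * v)⁻¹ * s * (t * w)⁻¹ * (s * v * (w * z)) := by
    rw [← e4, ← e3, ← e2, ← e1, commutatorElement_def]
    simp only [map_mul, MulAut.mul_apply]
  have hst : Commute v⁻¹ (t⁻¹ * s) := (hvt.inv_right.mul_right hvs).inv_left
  have hst' : Commute w⁻¹ (t⁻¹ * s) := (hwt.inv_right.mul_right hws).inv_left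
  calc ⁅⁅x, y⁆, z⁆ = MulAut.conj ⁅x, y⁆ z * z⁻¹ := by
        rw [MulAut.conj_apply, commutatorElement_def ⁅x, y⁆ z]
    _ = v⁻¹ * (w⁻¹ * (t⁻¹ * s)) * v * w := by rw [e5]; group
    _ = (v⁻¹ * (t⁻¹ * s)) * w⁻¹ * v * w := by rw [hst'.eq]; group
    _ = _ := by rw [hst.eq, commutatorElement_def]; group

/-- The image of `e_{-i}` shows `-u` in `V` and `ε_i a` in coordinate `i`, and `ε_i` is invertible.
-/
lemma longFun_injective {R : Type u} [Ring R] {J : PseudoInvolution R} {V : Type v}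
    [AddCommGroup V] [Module Rᵐᵒᵖ V] {B : AntiHermitianForm J V} {n : ℕ} (i : Idx n)
    {ξ ζ : Heisenberg B} (h : longFun B i ξ (e R V i.opp) = longFun B i ζ (e R V i.opp)) :
    ξ = ζ := by
  rw [longFun_eq, longFun_eq] at h
  obtain ⟨h1, h2⟩ := Prod.ext_iff.mp h
  have h1 := congrFun h1 i
  simp only [e, Pi.add_apply, Pi.single_eq_same, mul_one, map_zero, sub_zero] at h1 h2
  ext
  · simpa using h2
  · have h3 := congrArg (fun x => -(J.bar 1 * (eps J i.opp * x))) (add_left_cancel h1)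
    simpa only [eps_opp_mul_eps_assoc, mul_neg, neg_neg, J.bar_one_mul_inv_assoc] using h3

lemma StU.y_injective {R : Type u} [Ring R] {J : PseudoInvolution R} {V : Type v}
    [AddCommGroup V] [Module Rᵐᵒᵖ V] {B : AntiHermitianForm J V} (L : OddFormParameter B) {n : ℕ}
    (i : Idx n) : Function.Injective (StU.y L i) := fun ξ ζ h => by
  have h1 := congrArg (fun x => (StU.toEU L n x).1.1 (e R V i.opp)) h
  simp only [StU.y, StU.toEU_of] at h1
  exact Subtype.ext (longFun_injective i h1)

namespace IsCentralExtension

variable {R : Type u} [Ring R] {J : PseudoInvolution R} {V : Type v} [AddCommGroup V]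
  [Module Rᵐᵒᵖ V] {B : AntiHermitianForm J V} {L : OddFormParameter B} {n : ℕ}
  {E : Type*} [Group E] {p : E →* StU L n}

open Idx in
-- With `[Q, Z] = D Y` for lifts over a third index `k`, conjugation by `A` fixes `D` and `Z` and
-- multiplies `Q` by the short element `[A, Q]`. So `[A, Y] = [[A, Q], Z]`, a commutator of short
-- elements already known.
lemma br_y_y (h : IsCentralExtension p) (hn : 5 ≤ n) {i j : Idx n} (hij : i.1 ≠ j.1)
    (ξ ζ : L.toAddSubgroup) :
    h.br (StU.y L i ξ) (StU.y L j ζ) = h.liftX i j.opp (eps J i * B ξ.1.vec ζ.1.vec) := by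
  obtain ⟨k, hik, hjk, -, -⟩ := exists_fresh hn i.1 j.1 i.1 i.1
  have oij : i.1 ≠ j.opp.1 := hij
  have oik : i.1 ≠ k.opp.1 := hik
  have okj : k.1 ≠ j.opp.1 := hjk.symm
  have oikj : k.opp.1 ≠ j.opp.1 := hjk.symm
  set A := h.lift (StU.y L i ξ)
  set Q := h.lift (StU.y L k (L.conjAct ζ 1))
  set Z := h.lift (StU.x L k.opp j.opp 1)
  set D := h.liftX k j.opp (eps J k * (L.conjAct ζ 1).1.scal * 1)
  set Y := h.liftY j ζ
  set N := h.liftX i j.opp (eps J i * B ξ.1.vec ζ.1.vec)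
  have hpN : p N = StU.x L i j.opp _ := h.map_liftX hn oij _
  have hpD : p D = StU.x L k j.opp _ := h.map_liftX hn okj _
  have hpY : p Y = StU.y L j ζ := h.map_liftY hn _ _
  have hQZ : ⁅Q, Z⁆ = D * Y := by
    have := h.br_y_x hn okj (L.conjAct ζ 1) 1
    rwa [L.conjAct_conjAct_one, opp_opp] at this
  have hpAQ : p ⁅A, Q⁆ = StU.x L i k.opp (eps J i * B ξ.1.vec ζ.1.vec) := by
    rw [map_commutatorElement, map_lift, map_lift, StU.comm_y_y L hik, L.conjAct_vec]
    simp
  have hAQZ : ⁅⁅A, Q⁆, Z⁆ = N := by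
    rw [h.commutator_x_x hn oik oikj oij hpAQ (h.map_lift _), mul_one]
  have cAD : Commute A D :=
    h.commute_y_x hn (ne_opp_of_fst hik.symm) (ne_opp_of_fst hij).symm (h.map_lift _) hpD
  have cAZ : Commute A Z :=
    h.commute_y_x hn (by rw [Ne, opp_inj]; exact ne_of_fst hik.symm)
      (ne_opp_of_fst hij).symm (h.map_lift _) (h.map_lift _)
  have cPD : Commute ⁅A, Q⁆ D :=
    h.commute_x_x hn (ne_opp_self k) (ne_opp_of_fst hik.symm) (ne_opp_of_fst hij).symm
      (by rw [opp_opp]; exact (ne_opp_of_fst hjk.symm).symm) hpAQ hpD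
  have cPY : Commute Y ⁅A, Q⁆ :=
    h.commute_y_x hn (ne_opp_of_fst hij) (ne_opp_of_fst hjk).symm hpY hpAQ
  have cNY : Commute Y N :=
    h.commute_y_x hn (ne_opp_of_fst hij) (opp_ne j) hpY hpN
  have e1 : A * Y * A⁻¹ = Y * N := by
    have e2 : A * (D * Y) * A⁻¹ = (D * Y) * N := by
      calc A * (D * Y) * A⁻¹ = ⁅A * Q * A⁻¹, A * Z * A⁻¹⁆ := by
            rw [← hQZ]; simp only [commutatorElement_def]; group
        _ = ⁅⁅A, Q⁆ * Q, Z⁆ := by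
            rw [cAZ.eq, mul_inv_cancel_right, commutatorElement_def A Q]; group
        _ = _ := by
            rw [commutator_mul_left, hQZ, (cPD.mul_right cPY.symm).eq, mul_inv_cancel_right, hAQZ]
    rw [← mul_right_inj D, ← mul_assoc D Y N, ← e2, ← mul_assoc, ← mul_assoc, ← cAD.eq]
    simp only [mul_assoc]
  have e3 : ⁅A, Y⁆ = N := by
    rw [commutatorElement_def, e1, cNY.eq, mul_inv_cancel_right]
  rw [← e3, h.commutator_eq_br, map_lift, hpY]

lemma commutator_y_y (h : IsCentralExtension p) (hn : 5 ≤ n) {i j : Idx n} (hij : i.1 ≠ j.1)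
    {ξ ζ : L.toAddSubgroup} {a b : E} (ha : p a = StU.y L i ξ) (hb : p b = StU.y L j ζ) :
    ⁅a, b⁆ = h.liftX i j.opp (eps J i * B ξ.1.vec ζ.1.vec) := by
  rw [h.commutator_eq_br, ha, hb, h.br_y_y hn hij]

open Idx in
-- Expands `[A A', Z]`, with `A` over `ζ` and `A'` over `ξ` because `conjAct · 1` reverses sums.
-- Moving `A` past `liftY j ξ` produces the term `B(ζ, ξ)`, which is the one in the scalar part of
-- the sum.
lemma liftY_add (h : IsCentralExtension p) (hn : 5 ≤ n) (j : Idx n) (ξ ζ : L.toAddSubgroup) :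
    h.liftY j (ξ + ζ) = h.liftY j ξ * h.liftY j ζ := by
  obtain ⟨i, hji, -, -, -⟩ := exists_fresh hn j.1 j.1 j.1 j.1
  have oij : i.1 ≠ j.opp.1 := hji.symm
  set A := h.lift (StU.y L i (L.conjAct ζ 1))
  set A' := h.lift (StU.y L i (L.conjAct ξ 1))
  set Z := h.lift (StU.x L i.opp j.opp 1)
  have hX := fun c => h.map_liftX hn oij c
  have hY := fun ξ => h.map_liftY hn j ξ
  have key : ∀ ξ : L.toAddSubgroup, h.br (StU.y L i (L.conjAct ξ 1)) (StU.x L i.opp j.opp 1) =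
      h.liftX i j.opp (eps J i * (L.conjAct ξ 1).1.scal) * h.liftY j ξ := fun ξ => by
    rw [h.br_y_x hn oij, L.conjAct_conjAct_one, opp_opp, mul_one]
  have e1 := key (ξ + ζ)
  have e2 := h.commutator_eq_br (A * A') Z
  have hAA : p (A * A') = StU.y L i (L.conjAct (ξ + ζ) 1) := by
    rw [map_mul, map_lift, map_lift, ← StU.y_add, L.conjAct_add_one]
  have cA : ∀ c, Commute A (h.liftX i j.opp c) := fun c =>
    h.commute_y_x hn (ne_opp_self i) (ne_of_fst oij.symm) (h.map_lift _) (hX c)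
  have cY : ∀ ξ c, Commute (h.liftY j ξ) (h.liftX i j.opp c) := fun ξ c =>
    h.commute_y_x hn (ne_opp_of_fst hji.symm) (opp_ne j) (hY ξ) (hX c)
  have hAY : A * h.liftY j ξ * A⁻¹ = h.liftX i j.opp (eps J i * B ζ.1.vec ξ.1.vec) *
      h.liftY j ξ := by
    have : ⁅A, h.liftY j ξ⁆ = _ := h.commutator_y_y hn hji.symm (h.map_lift _) (hY ξ)
    rw [commutatorElement_def, mul_inv_eq_iff_eq_mul] at this
    rw [this]
    simp
  rw [hAA, map_lift, e1, commutator_mul_left] at e2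
  change A * h.br _ _ * A⁻¹ * h.br _ _ = _ at e2
  rw [key, key] at e2
  have e3 : eps J i * (L.conjAct (ξ + ζ) 1).1.scal = eps J i * (L.conjAct ξ 1).1.scal +
      eps J i * B ζ.1.vec ξ.1.vec + eps J i * (L.conjAct ζ 1).1.scal := by
    rw [L.conjAct_add_one, ← mul_add, ← mul_add]
    congr 1
    simp
    abel
  rw [e3, h.liftX_add hn oij, h.liftX_add hn oij] at e2
  set x1 := h.liftX i j.opp (eps J i * (L.conjAct ξ 1).1.scal)
  set x2 := h.liftX i j.opp (eps J i * B ζ.1.vec ξ.1.vec)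
  set x3 := h.liftX i j.opp (eps J i * (L.conjAct ζ 1).1.scal)
  rw [← mul_right_inj (x1 * x2 * x3), ← e2]
  calc A * (x1 * h.liftY j ξ) * A⁻¹ * (x3 * h.liftY j ζ)
      = (A * x1) * h.liftY j ξ * A⁻¹ * (x3 * h.liftY j ζ) := by group
    _ = x1 * (A * h.liftY j ξ * A⁻¹) * (x3 * h.liftY j ζ) := by
        rw [show A * x1 = x1 * A from (cA _).eq]; group
    _ = x1 * x2 * (h.liftY j ξ * x3) * h.liftY j ζ := by rw [hAY]; group
    _ = _ := by
        rw [show h.liftY j ξ * x3 = x3 * h.liftY j ξ from (cY _ _).eq]; group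

open Idx in
-- Evaluates `[[x, y], z]` for lifts of `X_{ik}(a)`, `X_{k,-i}(1)`, `X_{-i,-j}(1)` twice. As `[x,
-- y]` lies over a long generator, `br_y_x` gives a short factor times the left side;
-- `commutator_commutator_eq` gives the same short factor times `[v⁻¹, w⁻¹]`, a commutator of types
-- `X_{k,-j}` and `X_{-k,-j}`, hence a `liftZ`.
lemma liftY_conjAct_shortParam (h : IsCentralExtension p) (hn : 5 ≤ n) {i j : Idx n}
    (hij : i.1 ≠ j.1) (a : R) :
    h.liftY j (L.conjAct (shortParam L i a 1) 1) =
      h.liftZ j (-(eps J j * J.bar a * eps J i)) := by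
  obtain ⟨k, hik, hjk, -, -⟩ := exists_fresh hn i.1 j.1 i.1 i.1
  have oij : i.1 ≠ j.opp.1 := hij
  have oiij : i.opp.1 ≠ j.opp.1 := hij
  have okj : k.1 ≠ j.opp.1 := hjk.symm
  have okkj : k.opp.1 ≠ j.opp.1 := hjk.symm
  have oki : k.1 ≠ i.opp.1 := hik.symm
  have okki : k.opp.1 ≠ i.opp.1 := hik.symm
  set c := eps J k.opp * J.bar a * eps J i
  set d := eps J i * J.bar 1 * eps J k
  set x := h.lift (StU.x L i k a)
  set y := h.lift (StU.x L k i.opp 1)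
  set z := h.lift (StU.x L i.opp j.opp 1)
  set v := h.liftX k j.opp (1 : R)
  set w := h.liftX k.opp j.opp c
  set s := h.liftX i j.opp a
  set t := h.liftX i j.opp (d * c)
  have hx : p x = StU.x L i k a := h.map_lift _
  have hx' : p x = StU.x L k.opp i.opp c := by rw [hx, StU.x_opp]
  have hy : p y = StU.x L k i.opp 1 := h.map_lift _
  have hy' : p y = StU.x L i k.opp d := by rw [hy, StU.x_opp, opp_opp]
  have hz : p z = StU.x L i.opp j.opp 1 := h.map_lift _
  have hv : p v = StU.x L k j.opp 1 := h.map_liftX hn okj _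
  have hw : p w = StU.x L k.opp j.opp c := h.map_liftX hn okkj _
  have hs : p s = StU.x L i j.opp a := h.map_liftX hn oij _
  have ht : p t = StU.x L i j.opp (d * c) := h.map_liftX hn oij _
  have ojj : ∀ l : Idx n, l.1 ≠ j.1 → j.opp ≠ l := fun l hl => (ne_opp_of_fst hl).symm
  have ojj' : ∀ l : Idx n, l.1 ≠ j.1 → j.opp ≠ l.opp := fun l hl => ojj l.opp hl
  have key := commutator_commutator_eq (x := x) (y := y) (z := z) (v := v) (w := w) (s := s)
    (t := t)
    (by rw [h.commutator_x_x hn okki oiij okkj hx' hz, mul_one])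
    (by rw [h.commutator_x_x hn oki oiij okj hy hz, mul_one])
    (by rw [h.commutator_x_x hn hik okj oij hx hv, mul_one])
    (h.commutator_x_x hn (show i.1 ≠ k.opp.1 from hik) okkj oij hy' hw)
    (h.commute_x_x hn (opp_ne k) (by rw [Ne, opp_inj]; exact ne_of_fst hik.symm)
      (ojj i hij) (ojj' k hjk.symm) hx hw)
    (h.commute_x_x hn (ne_of_fst oki) (ne_opp_self k) (ojj k hjk.symm)
      (ojj' i.opp hij) hy hv)
    (h.commute_x_x hn (ne_of_fst hik) (ne_opp_self i) (ojj i hij) (ojj' k hjk.symm) hx hs)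
    (h.commute_x_x hn (ne_of_fst hik) (ne_opp_self i) (ojj i hij) (ojj' k hjk.symm) hx ht)
    (h.commute_x_x hn (ne_opp_self i) (ne_opp_of_fst hik) (ojj k hjk.symm)
      (ojj' i.opp hij) hy hs)
    (h.commute_x_x hn (ne_of_fst oij) (ne_opp_of_fst hik) (ojj k hjk.symm)
      (by rw [opp_opp]; exact opp_ne j) hv hs)
    (h.commute_x_x hn (ne_of_fst oij) (by rw [opp_opp]; exact ne_of_fst hik)
      (ojj' k hjk.symm) (by rw [opp_opp]; exact opp_ne j) hw hs)
    (h.commute_x_x hn (ne_of_fst oij) (ne_opp_of_fst hik) (ojj k hjk.symm)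
      (by rw [opp_opp]; exact opp_ne j) hv ht)
    (h.commute_x_x hn (ne_of_fst oij) (by rw [opp_opp]; exact ne_of_fst hik)
      (ojj' k hjk.symm) (by rw [opp_opp]; exact opp_ne j) hw ht)
  have hxy : p ⁅x, y⁆ = StU.y L i (shortParam L i a 1) := by
    rw [map_commutatorElement, hx, hy, StU.comm_x_x_opp L hik]
  rw [h.commutator_eq_br, hxy, hz, h.br_y_x hn oij, opp_opp, ← h.liftX_neg hn oij,
    ← h.liftX_add hn oij] at key
  have hdc : eps J i * (shortParam L i a 1).1.scal * 1 = -(d * c) + a := by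
    have e1 : eps J i * (eps J i.opp * (J.bar 1 * a)) = -a := by
      rw [eps_mul_eps_opp_assoc, J.inv_mul_bar_one_assoc]
    have e2 : eps J k * (eps J k.opp * (J.bar a * eps J i)) = -(J.inv * (J.bar a * eps J i)) :=
      eps_mul_eps_opp_assoc _ _
    simp only [shortParam, d, c, mul_assoc, mul_add, neg_mul, mul_neg, e1, e2, mul_one, neg_neg]
    abel
  rw [hdc, mul_right_inj, h.commutator_eq_br, map_inv, map_inv, hv, hw, ← StU.x_neg, ← StU.x_neg,
    StU.x_opp, opp_opp, h.br_x_x_opp hn (j := k.opp) hjk] at key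
  rw [key]
  congr 1
  have e2 : eps J k * (eps J k.opp * (J.bar a * eps J i)) = -(J.inv * (J.bar a * eps J i)) :=
    eps_mul_eps_opp_assoc _ _
  simp only [c, map_neg, mul_neg, neg_mul, neg_neg, mul_assoc, e2, J.bar_one_mul_inv_assoc]

lemma liftZ_eq_liftY (h : IsCentralExtension p) (hn : 5 ≤ n) (j : Idx n) (a : R) :
    h.liftZ j a = h.liftY j (shortParam L j 1 a) := by
  obtain ⟨i, hji, -, -, -⟩ := Idx.exists_fresh hn j.1 j.1 j.1 j.1
  -- Solvable because `ε_i`, `ε_j` are units and the bar is bijective.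
  obtain ⟨c, hc⟩ : ∃ c : R, -(eps J j * J.bar c * eps J i) = a := by
    refine ⟨J.bar (-(eps J j.opp * J.bar 1 * a * (J.bar 1 * eps J i.opp))), ?_⟩
    have e1 := eps_mul_eps_opp (J := J) i.opp
    rw [Idx.opp_opp] at e1
    simp only [J.bar_bar, mul_assoc, mul_neg, e1, J.bar_one_mul_inv, mul_one, neg_neg,
      eps_mul_eps_opp_assoc, J.inv_mul_bar_one_assoc]
  have key := h.liftY_conjAct_shortParam hn hji.symm c
  rw [hc] at key
  rw [← key]
  congr 1
  -- The two parameters need not be computed: by `key` their long generators have a common lift, so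
  -- they coincide.
  apply StU.y_injective L j
  rw [← h.map_liftY hn, key, h.map_liftZ hn]

/-- A central extension of the Steinberg group splits. -/
theorem exists_section (h : IsCentralExtension p) (hn : 5 ≤ n) :
    ∃ s : StU L n →* E, p.comp s = MonoidHom.id _ := by
  let f : Gen L n → E := fun g => match g with
    | .short i j _ a => h.liftX i j a
    | .long i ξ => h.liftY i ξ
  have fX : ∀ i j hij a, FreeGroup.lift f (X L i j hij a) = h.liftX i j a :=
    fun i j hij a => by simp [X, f]
  have fY : ∀ i (ξ : L.toAddSubgroup), FreeGroup.lift f (Y i ξ) = h.liftY i ξ :=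
    fun i ξ => by simp [Y, f]
  have hX : ∀ {i j : Idx n} (_ : i.Indep j) (a : R), p (h.liftX i j a) = StU.x L i j a :=
    fun hij a => h.map_liftX hn (Idx.indep_iff.mp hij) a
  have hY := h.map_liftY hn
  have hf : ∀ r ∈ {r | Relator L n r}, FreeGroup.lift f r = 1 := by
    intro r hr
    cases hr with
    | r0 i j hij hji a =>
      rw [map_mul, map_inv, fX, fX, mul_inv_eq_one]
      exact h.liftX_opp hn (Idx.indep_iff.mp hij) a
    | r1 i j hij a b =>
      rw [map_mul, map_mul, map_inv, fX, fX, fX, mul_inv_eq_one]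
      exact (h.liftX_add hn (Idx.indep_iff.mp hij) a b).symm
    | r2 i ξ ζ =>
      rw [map_mul, map_mul, map_inv, fY, fY, fY, mul_inv_eq_one]
      exact (h.liftY_add hn i ξ ζ).symm
    | r3 i j k l hij hkl h1 h2 h3 h4 a b =>
      rw [map_commutatorElement, fX, fX, commutatorElement_eq_one_iff_commute]
      exact h.commute_x_x hn h1 h2 h3 h4 (hX hij a) (hX hkl b)
    | r4 i j k hjk h1 h2 ξ a =>
      rw [map_commutatorElement, fX, fY, commutatorElement_eq_one_iff_commute]
      exact h.commute_y_x hn h1 h2 (hY i ξ) (hX hjk a)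
    | r5 i j k hij hjk hik a b =>
      rw [map_mul, map_inv, map_commutatorElement, fX, fX, fX, mul_inv_eq_one]
      exact h.commutator_x_x hn (Idx.indep_iff.mp hij) (Idx.indep_iff.mp hjk)
        (Idx.indep_iff.mp hik) (hX hij a) (hX hjk b)
    | r6 i j hij hij' ξ ζ =>
      rw [map_mul, map_inv, map_commutatorElement, fX, fY, fY, mul_inv_eq_one]
      exact h.commutator_y_y hn (Idx.indep_iff.mp hij) (hY i ξ) (hY j ζ)
    | r7 i ξ ζ =>
      rw [map_mul, map_inv, map_commutatorElement, fY, fY, fY, mul_inv_eq_one,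
        commutatorElement_def, mul_inv_eq_iff_eq_mul, mul_inv_eq_iff_eq_mul, mul_assoc,
        ← h.liftY_add hn, ← h.liftY_add hn, ← h.liftY_add hn]
      -- The relation is now additivity applied to `ξ ∔ ζ = (0, B(u, v) - B(v, u)) ∔ (ζ ∔ ξ)`.
      congr 1
      apply OddFormParameter.ext_val
      · simp [commParam, add_comm]
      · simp [commParam]
        abel
    | r8 i j hij hij' ξ b =>
      rw [map_mul, map_inv, map_commutatorElement, map_mul, fX, fX, fY, fY, mul_inv_eq_one,
        h.commutator_eq_br, hX hij', hY]
      exact h.br_y_x hn (Idx.indep_iff.mp hij) ξ b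
    | r9 i j hij hji a b =>
      rw [map_mul, map_inv, map_commutatorElement, fX, fX, fY, mul_inv_eq_one,
        h.commutator_eq_br, hX hij, hX hji, h.br_x_x_opp hn (Idx.indep_iff.mp hij),
        h.liftZ_eq_liftY hn]
      congr 1
      apply OddFormParameter.ext_val
      · rfl
      · simp [shortParam, mul_assoc, J.bar_mul', J.inv_mul_bar_one_assoc]
  refine ⟨PresentedGroup.toGroup hf, PresentedGroup.ext fun g => ?_⟩
  cases g with
  | short i j hij a =>
    simpa [f, StU.x_of_indep L hij] using hX hij a
  | long i ξ => exact (congrArg p (PresentedGroup.toGroup.of hf)).trans (hY i ξ)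

end IsCentralExtension

/-! ### The universal property of the Steinberg group -/

/-- The two maps differ by central factors, so they agree on commutators, which generate `U`. -/
lemma eq_of_comp_eq {U G H : Type*} [Group U] [Group G] [Group H] (hU : commutator U = ⊤)
    {ε : H →* G} (hε : ε.ker ≤ Subgroup.center H) {η θ : U →* H} (h : ε.comp η = ε.comp θ) :
    η = θ := by
  have key : commutator U ≤ MonoidHom.eqLocus η θ := by
    rw [commutator_def, Subgroup.commutator_le]
    intro x _ y _
    change η ⁅x, y⁆ = θ ⁅x, y⁆
    rw [map_commutatorElement, map_commutatorElement]
    exact IsCentralExtension.commutator_congr hε (DFunLike.congr_fun h x) (DFunLike.congr_fun h y)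
  rw [hU] at key
  exact MonoidHom.ext fun x => key (Subgroup.mem_top x)

section universalProperty

variable {R : Type u} [Ring R] {J : PseudoInvolution R} {V : Type v} [AddCommGroup V]
  [Module Rᵐᵒᵖ V] {B : AntiHermitianForm J V} (L : OddFormParameter B) {n : ℕ}

/-- The fibre product of `ε` and `f` is a central extension of `StU`; a section followed by the
projection to `H` is the required map. Since `f` need not be surjective, the lemma also applies to
the finite stages of the direct limit. -/
theorem StU.exists_lift (hn : 5 ≤ n) {G H : Type*} [Group G] [Group H] (f : StU L n →* G)
    {ε : H →* G} (hε : ε.ker ≤ Subgroup.center H) (hf : ∀ x, f x ∈ ε.range) :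
    ∃ η : StU L n →* H, ε.comp η = f := by
  let E : Subgroup (H × StU L n) :=
    MonoidHom.eqLocus (ε.comp (MonoidHom.fst _ _)) (f.comp (MonoidHom.snd _ _))
  let p : E →* StU L n := (MonoidHom.snd _ _).comp E.subtype
  have hp : IsCentralExtension p := by
    refine ⟨fun x => ?_, ?_⟩
    · obtain ⟨y, hy⟩ := hf x
      exact ⟨⟨(y, x), hy⟩, rfl⟩
    · rintro ⟨⟨y, x⟩, hyx⟩ hx
      obtain rfl : x = 1 := hx
      have hy : y ∈ Subgroup.center H := hε (hyx.trans (map_one f))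
      rw [Subgroup.mem_center_iff] at hy ⊢
      rintro ⟨⟨y', x'⟩, _⟩
      exact Subtype.ext (Prod.ext (hy y') (by simp))
  obtain ⟨s, hs⟩ := hp.exists_section hn
  refine ⟨((MonoidHom.fst _ _).comp E.subtype).comp s, MonoidHom.ext fun x => ?_⟩
  have h1 : ε (s x).1.1 = f (s x).1.2 := (s x).2
  have h2 : (s x).1.2 = x := DFunLike.congr_fun hs x
  exact h1.trans (congrArg f h2)

lemma StU.commutator_eq_top (hn : 5 ≤ n) : commutator (StU L n) = ⊤ := by
  have hx : ∀ i j : Idx n, i.1 ≠ j.1 → ∀ a, StU.x L i j a ∈ commutator (StU L n) := by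
    intro i j hij a
    obtain ⟨h1, h2⟩ := Idx.fresh_spec hn i j
    rw [← one_mul a, ← StU.comm_x_x L h1 h2.symm hij]
    exact Subgroup.commutator_mem_commutator (Subgroup.mem_top _) (Subgroup.mem_top _)
  refine StU.eq_top_of_mem L hx fun i ξ => ?_
  obtain ⟨h1, -⟩ := Idx.fresh_spec hn i i
  rw [StU.y_eq L h1.symm]
  exact mul_mem (inv_mem (hx _ _ (show (Idx.fresh i i).1 ≠ i.opp.1 from h1.symm) _))
    (Subgroup.commutator_mem_commutator (Subgroup.mem_top _) (Subgroup.mem_top _))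

lemma StU.isSchurMultiplier (hn : 5 ≤ n) (hK : K2U L n ≤ Subgroup.center (StU L n)) :
    IsSchurMultiplier.{w} (K2U L n).subtype (StU.toEU L n) where
  injective := Subtype.val_injective
  range_eq := Subgroup.range_subtype _
  universal := by
    refine ⟨⟨StU.toEU_surjective L n, hK⟩, fun H _ ε hε => ?_⟩
    obtain ⟨η, hη⟩ := StU.exists_lift L hn (StU.toEU L n) hε.2 fun x => hε.1 _
    exact ⟨η, hη, fun θ hθ => eq_of_comp_eq (StU.commutator_eq_top L hn) hε.2 (hθ.trans hη.symm)⟩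

end universalProperty

/-! ### Unipotent radicals and the centrality of the image of `K₂U` -/

section radical

variable {R : Type u} [Ring R] {J : PseudoInvolution R} {V : Type v} [AddCommGroup V]
  [Module Rᵐᵒᵖ V] {B : AntiHermitianForm J V} (L : OddFormParameter B) {n : ℕ}

/-- The subgroup generated by all `X_{rl}(a)` and `X_r(ξ)`. -/
def StU.radical (r : Idx n) : Subgroup (StU L n) :=
  Subgroup.closure ({g | ∃ l a, g = StU.x L r l a} ∪ Set.range (StU.y L r))

variable {L}

lemma StU.x_mem_radical (r l : Idx n) (a : R) : StU.x L r l a ∈ StU.radical L r :=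
  Subgroup.subset_closure (Or.inl ⟨l, a, rfl⟩)

lemma StU.y_mem_radical (r : Idx n) (ξ : L.toAddSubgroup) : StU.y L r ξ ∈ StU.radical L r :=
  Subgroup.subset_closure (Or.inr ⟨ξ, rfl⟩)

lemma StU.x_opp_mem_radical (r l : Idx n) (a : R) : StU.x L l r.opp a ∈ StU.radical L r := by
  rw [StU.x_opp, Idx.opp_opp]
  exact StU.x_mem_radical _ _ _

lemma StU.y_zero (i : Idx n) : StU.y L i 0 = 1 := by simpa using StU.y_add L i 0 0

lemma StU.y_neg (i : Idx n) (ξ : L.toAddSubgroup) : StU.y L i (-ξ) = (StU.y L i ξ)⁻¹ := by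
  rw [eq_inv_iff_mul_eq_one, ← StU.y_add, neg_add_cancel, StU.y_zero]

open Idx in
lemma StU.commutator_x_mem_radical {i j r : Idx n} (hi : i.1 ≠ r.1) (hj : j.1 ≠ r.1) (a : R)
    {u : StU L n} (hu : u ∈ ({g | ∃ l a, g = StU.x L r l a} ∪ Set.range (StU.y L r) :
      Set (StU L n))) : ⁅StU.x L i j a, u⁆ ∈ StU.radical L r := by
  by_cases hij : i.1 = j.1
  · simp [StU.x_eq_one L hij]
  rcases hu with ⟨l, b, rfl⟩ | ⟨ξ, rfl⟩
  · by_cases hl : l = i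
    · subst hl
      rw [← commutatorElement_inv, StU.comm_x_x L hi.symm hij hj.symm]
      exact inv_mem (StU.x_mem_radical _ _ _)
    by_cases hl' : l = j.opp
    · subst hl'
      rw [StU.x_opp, ← commutatorElement_inv,
        StU.comm_x_x L (show r.1 ≠ j.opp.1 from hj.symm)
          (show j.opp.1 ≠ i.opp.1 from Ne.symm hij) (show r.1 ≠ i.opp.1 from hi.symm)]
      exact inv_mem (StU.x_mem_radical _ _ _)
    rw [commutatorElement_eq_one_iff_commute.mpr (StU.commute_x_x L (ne_of_fst hj.symm)
      (ne_opp_of_fst hi.symm) hl hl' _ _)]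
    exact one_mem _
  · rw [commutatorElement_eq_one_iff_commute.mpr (StU.commute_y_x L (ne_opp_of_fst hi)
      (ne_of_fst hj) _ _).symm]
    exact one_mem _

open Idx in
lemma StU.commutator_y_mem_radical {i r : Idx n} (hi : i.1 ≠ r.1) (ξ : L.toAddSubgroup)
    {u : StU L n} (hu : u ∈ ({g | ∃ l a, g = StU.x L r l a} ∪ Set.range (StU.y L r) :
      Set (StU L n))) : ⁅StU.y L i ξ, u⁆ ∈ StU.radical L r := by
  rcases hu with ⟨l, b, rfl⟩ | ⟨ζ, rfl⟩
  · by_cases hl : l = i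
    · subst hl
      rw [StU.x_opp, StU.comm_y_x L (show l.1 ≠ r.opp.1 from hi), opp_opp]
      exact mul_mem (StU.x_opp_mem_radical _ _ _) (StU.y_mem_radical _ _)
    · rw [commutatorElement_eq_one_iff_commute.mpr (StU.commute_y_x L (ne_opp_of_fst hi.symm)
        hl _ _)]
      exact one_mem _
  · rw [StU.comm_y_y L hi]
    exact StU.x_opp_mem_radical _ _ _

/-- The condition on `s⁻¹` is needed for the converse implication: a conjugate of a subgroup may be
strictly smaller. -/
lemma mem_normalizer_closure {G : Type*} [Group G] {T : Set G} {s : G}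
    (h1 : ∀ t ∈ T, ⁅s, t⁆ ∈ Subgroup.closure T) (h2 : ∀ t ∈ T, ⁅s⁻¹, t⁆ ∈ Subgroup.closure T) :
    ∀ t, t ∈ Subgroup.closure T ↔ s * t * s⁻¹ ∈ Subgroup.closure T := by
  have key : ∀ s : G, (∀ t ∈ T, ⁅s, t⁆ ∈ Subgroup.closure T) →
      ∀ t ∈ Subgroup.closure T, s * t * s⁻¹ ∈ Subgroup.closure T := by
    intro s hs
    suffices Subgroup.closure T ≤ (Subgroup.closure T).comap (MulAut.conj s).toMonoidHom from
      fun t ht => this ht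
    rw [Subgroup.closure_le]
    intro t ht
    have := mul_mem (hs t ht) (Subgroup.subset_closure ht)
    rwa [commutatorElement_def, inv_mul_cancel_right] at this
  refine fun t => ⟨key s h1 t, fun ht => ?_⟩
  have := key s⁻¹ h2 _ ht
  rwa [inv_inv, mul_assoc s t, inv_mul_cancel_left, inv_mul_cancel_right] at this

/-- The image of the smaller group plays the role of a Levi factor: its generators involve no index
`±r`, so their commutators with generators of the radical stay in the radical. -/
lemma StU.stab_mem_normalizer {m : ℕ} (h : m ≤ n) {r : Idx n} (hr : m ≤ r.1.1) (g : StU L m) :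
    ∀ t, t ∈ StU.radical L r ↔
      StU.stab L h g * t * (StU.stab L h g)⁻¹ ∈ StU.radical L r := by
  have hne : ∀ i : Idx m, (i.castLE h).1 ≠ r.1 := fun i e => by
    have h1 : i.1.1 = r.1.1 := congrArg Fin.val e
    have h2 := i.1.2
    omega
  have key : (Subgroup.normalizer (StU.radical L r : Set (StU L n))).comap (StU.stab L h) = ⊤ := by
    refine StU.eq_top_of_mem L (fun i j hij a => ?_) (fun i ξ => ?_)
    · rw [Subgroup.mem_comap, StU.x_of_indep L (Idx.indep_iff.mpr hij), StU.stab_of,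
        Subgroup.mem_normalizer_iff]
      change ∀ t, _ ∈ Subgroup.closure _ ↔ _ ∈ Subgroup.closure _
      have e : PresentedGroup.of (Gen.castLE L h (.short i j (Idx.indep_iff.mpr hij) a)) =
        StU.x L (i.castLE h) (j.castLE h) a := (StU.x_of_indep L _ a).symm
      rw [e]
      refine mem_normalizer_closure (fun t ht => StU.commutator_x_mem_radical (hne i) (hne j) a ht)
        fun t ht => ?_
      rw [← StU.x_neg]
      exact StU.commutator_x_mem_radical (hne i) (hne j) _ ht
    · rw [Subgroup.mem_comap, StU.y, StU.stab_of, Subgroup.mem_normalizer_iff]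
      change ∀ t, _ ∈ Subgroup.closure _ ↔ _ ∈ Subgroup.closure _
      have e : PresentedGroup.of (Gen.castLE L h (.long i ξ)) = StU.y L (i.castLE h) ξ := rfl
      rw [e]
      refine mem_normalizer_closure (fun t ht => StU.commutator_y_mem_radical (hne i) ξ ht)
        fun t ht => ?_
      rw [← StU.y_neg]
      exact StU.commutator_y_mem_radical (hne i) _ ht
  have hg : g ∈ (Subgroup.normalizer (StU.radical L r : Set (StU L n))).comap (StU.stab L h) := by
    rw [key]; exact Subgroup.mem_top g
  exact Subgroup.mem_normalizer_iff.mp (Subgroup.mem_comap.mp hg)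

/-- The ordered product of the elements `X_{rl}(c_l)`. -/
noncomputable def StU.xProd (L : OddFormParameter B) (r : Idx n) (s : List (Idx n))
    (c : Idx n → R) : StU L n :=
  (s.map fun l => StU.x L r l (c l)).prod

lemma StU.xProd_cons (r l : Idx n) (s : List (Idx n)) (c : Idx n → R) :
    StU.xProd L r (l :: s) c = StU.x L r l (c l) * StU.xProd L r s c := by
  simp [StU.xProd]

open Idx in
lemma StU.commute_y_x_self (r l : Idx n) (ξ : L.toAddSubgroup) (a : R) :
    Commute (StU.y L r ξ) (StU.x L r l a) := by
  by_cases h : r.1 = l.1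
  · rw [StU.x_eq_one L h]; exact Commute.one_right _
  · exact StU.commute_y_x L (ne_opp_self r) (ne_of_fst (Ne.symm h)) _ _

lemma StU.commute_y_xProd (r : Idx n) (s : List (Idx n)) (ξ : L.toAddSubgroup) (c : Idx n → R) :
    Commute (StU.y L r ξ) (StU.xProd L r s c) := by
  induction s with
  | nil => exact Commute.one_right _
  | cons l s ih =>
    rw [StU.xProd_cons]
    exact (StU.commute_y_x_self r l ξ _).mul_right ih

open Idx in
-- Generators `X_{rl}`, `X_{rk}` commute unless `k = -l`, when their commutator is some `X_r(ξ)`,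
-- which commutes with both: the radical is nilpotent of Heisenberg type.
lemma StU.x_mul_x (r l k : Idx n) (a b : R) :
    ∃ ξ, StU.x L r l a * StU.x L r k b = StU.x L r k b * StU.x L r l a * StU.y L r ξ := by
  by_cases hl : r.1 = l.1
  · exact ⟨0, by simp [StU.x_eq_one L hl, StU.y_zero]⟩
  by_cases hk : r.1 = k.1
  · exact ⟨0, by simp [StU.x_eq_one L hk, StU.y_zero]⟩
  by_cases hlk : k = l.opp
  · subst hlk
    have e := StU.comm_x_x_opp L hl a (eps J l * J.bar b * eps J r)
    have e1 := StU.x_opp L r l.opp b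
    rw [opp_opp] at e1
    rw [← e1] at e
    refine ⟨shortParam L r a (eps J l * J.bar b * eps J r), ?_⟩
    rw [← ((StU.commute_y_x_self r l.opp _ b).mul_right (StU.commute_y_x_self r l _ a)).eq, ← e,
      commutatorElement_def]
    group
  · refine ⟨0, ?_⟩
    rw [StU.y_zero, mul_one]
    exact StU.commute_x_x L (ne_of_fst hl) (ne_opp_self r) (ne_of_fst (Ne.symm hk)) hlk _ _

lemma StU.xProd_mul_x (r k : Idx n) (s : List (Idx n)) (c : Idx n → R) (b : R) :
    ∃ ξ, StU.xProd L r s c * StU.x L r k b =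
      StU.x L r k b * StU.xProd L r s c * StU.y L r ξ := by
  induction s with
  | nil => exact ⟨0, by simp [StU.xProd, StU.y_zero]⟩
  | cons l s ih =>
    obtain ⟨ξ, hξ⟩ := ih
    obtain ⟨ζ, hζ⟩ := StU.x_mul_x (L := L) r l k (c l) b
    refine ⟨ζ + ξ, ?_⟩
    rw [StU.xProd_cons, mul_assoc, hξ, StU.y_add]
    calc StU.x L r l (c l) * (StU.x L r k b * StU.xProd L r s c * StU.y L r ξ)
        = (StU.x L r l (c l) * StU.x L r k b) * StU.xProd L r s c * StU.y L r ξ := by group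
      _ = StU.x L r k b * StU.x L r l (c l) * (StU.y L r ζ * StU.xProd L r s c) *
          StU.y L r ξ := by rw [hζ]; group
      _ = _ := by rw [(StU.commute_y_xProd r s ζ c).eq]; group

/-- The new factor is moved left into its own slot `k`. The last clause keeps the head coefficient
unchanged in the induction. -/
lemma StU.xProd_mul_x_of_mem (r k : Idx n) {s : List (Idx n)} (hs : s.Nodup) (hk : k ∈ s)
    (c : Idx n → R) (b : R) :
    ∃ c' ξ, StU.xProd L r s c * StU.x L r k b = StU.xProd L r s c' * StU.y L r ξ ∧
      ∀ l ∉ s, c' l = c l := by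
  induction s with
  | nil => simp at hk
  | cons l s ih =>
    rw [List.nodup_cons] at hs
    by_cases hkl : k = l
    · subst hkl
      obtain ⟨ξ, hξ⟩ := StU.xProd_mul_x (L := L) r k s c b
      refine ⟨Function.update c k (c k + b), ξ, ?_, fun l hl => ?_⟩
      · have : StU.xProd L r s (Function.update c k (c k + b)) = StU.xProd L r s c := by
          unfold StU.xProd
          congr 1
          refine List.map_congr_left fun l hl => ?_
          rw [Function.update_of_ne (fun e => hs.1 (by rwa [← e]))]
        rw [StU.xProd_cons, StU.xProd_cons, this, mul_assoc, hξ, Function.update_self, StU.x_add]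
        group
      · exact Function.update_of_ne (fun e => hl (by simp [e])) _ _
    · obtain ⟨c', ξ, h1, h2⟩ := ih hs.2 ((List.mem_cons.mp hk).resolve_left hkl)
      refine ⟨c', ξ, ?_, fun l' hl' => h2 l' (fun h => hl' (List.mem_cons_of_mem _ h))⟩
      rw [StU.xProd_cons, StU.xProd_cons, mul_assoc, h1, h2 l hs.1, mul_assoc]

/-- A normal form for the radical, preserved by right multiplication with generators and their
inverses. -/
lemma StU.exists_eq_of_mem_radical (r : Idx n) {g : StU L n} (hg : g ∈ StU.radical L r) :
    ∃ c ξ, g = StU.xProd L r Finset.univ.toList c * StU.y L r ξ := by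
  have hx : ∀ g k b, (∃ c ξ, g = StU.xProd L r Finset.univ.toList c * StU.y L r ξ) →
      ∃ c ξ, g * StU.x L r k b = StU.xProd L r Finset.univ.toList c * StU.y L r ξ := by
    rintro _ k b ⟨c, ξ, rfl⟩
    obtain ⟨c', ζ, h, -⟩ := StU.xProd_mul_x_of_mem (L := L) r k (Finset.nodup_toList Finset.univ)
      (by simp) c b
    refine ⟨c', ζ + ξ, ?_⟩
    rw [mul_assoc, (StU.commute_y_x_self r k ξ b).eq, ← mul_assoc, h, StU.y_add, mul_assoc]
  have hy : ∀ g ζ, (∃ c ξ, g = StU.xProd L r Finset.univ.toList c * StU.y L r ξ) →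
      ∃ c ξ, g * StU.y L r ζ = StU.xProd L r Finset.univ.toList c * StU.y L r ξ := by
    rintro _ ζ ⟨c, ξ, rfl⟩
    exact ⟨c, ξ + ζ, by rw [StU.y_add, mul_assoc]⟩
  induction hg using Subgroup.closure_induction_right with
  | one => exact ⟨0, 0, by simp [StU.xProd, StU.x_zero, StU.y_zero]⟩
  | mul_right g hg t ht ih =>
    rcases ht with ⟨l, a, rfl⟩ | ⟨ξ, rfl⟩
    · exact hx g l a ih
    · exact hy g ξ ih
  | mul_inv_cancel g hg t ht ih =>
    rcases ht with ⟨l, a, rfl⟩ | ⟨ξ, rfl⟩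
    · rw [← StU.x_neg]; exact hx g l _ ih
    · rw [← StU.y_neg]; exact hy g _ ih

lemma StU.toEU_x_apply {i j : Idx n} (h : i.Indep j) (a : R) (w : HypSpace R V n) :
    (StU.toEU L n (StU.x L i j a)).1.1 w = shortFun B i j a w := by
  rw [StU.x_of_indep L h, StU.toEU_of]
  rfl

lemma StU.toEU_y_apply (i : Idx n) (ξ : L.toAddSubgroup) (w : HypSpace R V n) :
    (StU.toEU L n (StU.y L i ξ)).1.1 w = longFun B i ξ.1 w := by
  rw [StU.y, StU.toEU_of]
  rfl

/-- The vanishing of coordinate `-r` removes the term along `e_{-l}` from every factor, so only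
coordinate `r` changes. -/
lemma StU.toEU_xProd_apply (r : Idx n) (s : List (Idx n)) (c : Idx n → R) (w : HypSpace R V n)
    (hw : w.1 r.opp = 0) :
    (StU.toEU L n (StU.xProd L r s c)).1.1 w =
      (w.1 + Pi.single r (s.map fun l => if r.1 = l.1 then 0 else c l * w.1 l).sum, w.2) := by
  induction s with
  | nil => simp [StU.xProd]
  | cons l s ih =>
    rw [StU.xProd_cons, map_mul]
    change (StU.toEU L n (StU.x L r l (c l))).1.1 ((StU.toEU L n (StU.xProd L r s c)).1.1 w) = _
    rw [ih, List.map_cons, List.sum_cons]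
    by_cases h : r.1 = l.1
    · rw [StU.x_eq_one L h, if_pos h, zero_add, map_one]
      rfl
    · rw [StU.toEU_x_apply (Idx.indep_iff.mpr h), shortFun_eq, if_neg h]
      simp [hw, r.opp_ne, (Idx.ne_of_fst h).symm, Pi.single_add, add_comm, add_left_comm]

/-- The transvections determine the normal form: the images of the `e_l` give the `c_l`, and then
the image of `e_{-r}` gives `ξ`. The coefficients at `l = ±r` stay undetermined but multiply trivial
factors. -/
lemma StU.eq_one_of_mem_radical {r : Idx n} {g : StU L n} (hg : g ∈ StU.radical L r)
    (h : StU.toEU L n g = 1) : g = 1 := by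
  obtain ⟨c, ξ, rfl⟩ := StU.exists_eq_of_mem_radical r hg
  have happ : ∀ w, (StU.toEU L n (StU.xProd L r Finset.univ.toList c)).1.1
      ((StU.toEU L n (StU.y L r ξ)).1.1 w) = w := fun w => by
    have := congrArg (fun x : EU L n => x.1.1 w) h
    rw [map_mul] at this
    exact this
  have hc : ∀ l : Idx n, r.1 ≠ l.1 → c l = 0 := by
    intro l hl
    have h1 := happ (e R V l)
    have hne : r.opp ≠ l := Idx.ne_of_fst hl
    have hl0 : (e R V l).1 r.opp = 0 := by simp [e, hne]
    have h2 : (StU.toEU L n (StU.y L r ξ)).1.1 (e R V l) = e R V l := by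
      rw [StU.toEU_y_apply, longFun_eq, hl0]
      simp [e]
    rw [h2, StU.toEU_xProd_apply r _ c _ hl0] at h1
    have h3 := congrFun (congrArg Prod.fst h1) r
    rw [Finset.sum_map_toList] at h3
    simp only [Pi.add_apply, Pi.single_eq_same, add_eq_left] at h3
    rw [Finset.sum_eq_single l (fun k _ hk => by simp [e, hk]) (by simp)] at h3
    simpa [e, hl] using h3
  have hT : StU.xProd L r Finset.univ.toList c = 1 := by
    refine List.prod_eq_one fun t ht => ?_
    obtain ⟨l, -, rfl⟩ := List.mem_map.mp ht
    by_cases hl : r.1 = l.1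
    · exact StU.x_eq_one L hl _
    · rw [hc l hl, StU.x_zero]
  rw [hT] at happ ⊢
  have hξ : ξ.1 = 0 := by
    refine longFun_injective (B := B) r ?_
    rw [← StU.toEU_y_apply, longFun_zero]
    simpa using happ (e R V r.opp)
  rw [show ξ = 0 from Subtype.ext hξ, StU.y_zero, one_mul]

/-- All generators involving `±r` lie in one of the two radicals; the others are obtained from these
by commutators through `r`. -/
lemma StU.eq_top_of_radical_le {r : Idx n} {K : Subgroup (StU L n)}
    (h1 : StU.radical L r ≤ K) (h2 : StU.radical L r.opp ≤ K) : K = ⊤ := by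
  have hr : ∀ i : Idx n, i.1 = r.1 → StU.radical L i ≤ K := by
    rintro ⟨i, a⟩ hi
    obtain rfl : i = r.1 := hi
    by_cases ha : a = r.2
    · rw [ha]; exact h1
    · have : a = !r.2 := by cases a <;> cases hb : r.2 <;> simp_all
      rw [this]
      exact h2
  have hx : ∀ i j : Idx n, i.1 = r.1 ∨ j.1 = r.1 → ∀ a, StU.x L i j a ∈ K := by
    rintro i j (hi | hj) a
    · exact hr i hi (StU.x_mem_radical _ _ _)
    · rw [StU.x_opp]
      exact hr j.opp hj (StU.x_mem_radical _ _ _)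
  have hcomm : ∀ {x y}, x ∈ K → y ∈ K → ⁅x, y⁆ ∈ K := fun hx hy =>
    mul_mem (mul_mem (mul_mem hx hy) (inv_mem hx)) (inv_mem hy)
  refine StU.eq_top_of_mem L (fun i j hij a => ?_) (fun i ξ => ?_)
  · by_cases hi : i.1 = r.1
    · exact hx i j (Or.inl hi) a
    by_cases hj : j.1 = r.1
    · exact hx i j (Or.inr hj) a
    rw [← one_mul a, ← StU.comm_x_x L hi (Ne.symm hj) hij]
    exact hcomm (hx _ _ (Or.inr rfl) _) (hx _ _ (Or.inl rfl) _)
  · by_cases hi : i.1 = r.1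
    · exact hr i hi (StU.y_mem_radical _ _)
    rw [StU.y_eq L (Ne.symm hi)]
    exact mul_mem (inv_mem (hx _ _ (Or.inl rfl) _))
      (hcomm (h1 (StU.y_mem_radical _ _)) (hx r.opp _ (Or.inl rfl) _))

variable (L)

/-- The image of `K₂U(2m, R, 𝔏)` in `StU(2n, R, 𝔏)`, `m < n`, is central. -/
theorem K2U.stab_mem_center {m : ℕ} (h : m < n) (x : K2U L m) :
    StU.stab L h.le x.1 ∈ Subgroup.center (StU L n) := by
  have hx1 : StU.toEU L n (StU.stab L h.le x.1) = 1 := (K2U.stab L h.le x).2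
  set s := StU.stab L h.le x.1
  have key : ∀ r : Idx n, m ≤ r.1.1 → StU.radical L r ≤ Subgroup.centralizer {s} := by
    intro r hr g hg
    have hg' := (StU.stab_mem_normalizer h.le hr x.1 g).mp hg
    -- The commutator lies in the radical, because `s` normalizes it, and in the kernel of the map
    -- to `EU`, because `s` does.
    have h1 : s * g * s⁻¹ * g⁻¹ = 1 :=
      StU.eq_one_of_mem_radical (mul_mem hg' (inv_mem hg)) (by simp [hx1])
    rw [Subgroup.mem_centralizer_singleton_iff]
    exact (commutatorElement_eq_one_iff_mul_comm.mp h1).symm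
  -- Counting from zero, `m` is the first index outside the smaller group; it exists because `m <
  -- n`.
  let r : Idx n := (⟨m, h⟩, true)
  have htop := StU.eq_top_of_radical_le (key r le_rfl) (key r.opp le_rfl)
  rw [Subgroup.mem_center_iff]
  intro g
  have hg : g ∈ Subgroup.centralizer {s} := by rw [htop]; exact Subgroup.mem_top g
  exact (Subgroup.mem_centralizer_singleton_iff.mp hg)

lemma K2U.le_center_of_stab_surjective (hn : 5 ≤ n)
    (hs : Function.Surjective (K2U.stab L (Nat.sub_le n 1))) :
    K2U L n ≤ Subgroup.center (StU L n) := by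
  intro x hx
  obtain ⟨y, hy⟩ := hs ⟨x, hx⟩
  have := K2U.stab_mem_center L (show n - 1 < n by omega) y
  rwa [← K2U.coe_stab, hy] at this

end radical

/-! ### The stable groups -/

section limits

variable {R : Type u} [Ring R] {J : PseudoInvolution R} {V : Type v} [AddCommGroup V]
  [Module Rᵐᵒᵖ V] {B : AntiHermitianForm J V} (L : OddFormParameter B)

/-- The canonical homomorphism `StU(2n, R, 𝔏) → StU(R, 𝔏)`. -/
noncomputable def StUInf.of (n : Rank) : StU L n.1 →* StUInf L where
  toFun x := ⟦⟨n, x⟩⟧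
  map_one' := (DirectLimit.one_def n).symm
  map_mul' x y := by rw [DirectLimit.mul_def]

/-- The canonical homomorphism `EU(2n, R, 𝔏) → EU(R, 𝔏)`. -/
noncomputable def EUInf.of (n : Rank) : EU L n.1 →* EUInf L where
  toFun x := ⟦⟨n, x⟩⟧
  map_one' := (DirectLimit.one_def n).symm
  map_mul' x y := by rw [DirectLimit.mul_def]

/-- The canonical homomorphism `K₂U(2n, R, 𝔏) → K₂U(R, 𝔏)`. -/
noncomputable def K2UInf.of (n : Rank) : K2U L n.1 →* K2UInf L where
  toFun x := ⟦⟨n, x⟩⟧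
  map_one' := (DirectLimit.one_def n).symm
  map_mul' x y := by rw [DirectLimit.mul_def]

variable {L}

lemma StUInf.exists_of (x : StUInf L) : ∃ n y, x = StUInf.of L n y :=
  DirectLimit.exists_eq_mk _ x

lemma EUInf.exists_of (x : EUInf L) : ∃ n y, x = EUInf.of L n y :=
  DirectLimit.exists_eq_mk _ x

lemma K2UInf.exists_of (x : K2UInf L) : ∃ n y, x = K2UInf.of L n y :=
  DirectLimit.exists_eq_mk _ x

lemma StUInf.of_stab {n m : Rank} (h : n ≤ m) (x : StU L n.1) :
    StUInf.of L m (StU.stab L h x) = StUInf.of L n x := by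
  have e := DirectLimit.eq_of_le (f := fun (n m : Rank) h => StU.stab L (Subtype.coe_le_coe.mpr h))
    (⟨n, x⟩ : Σ n : Rank, StU L n.1) m h
  exact e.symm

lemma K2UInf.of_stab {n m : Rank} (h : n ≤ m) (x : K2U L n.1) :
    K2UInf.of L m (K2U.stab L h x) = K2UInf.of L n x := by
  have e := DirectLimit.eq_of_le (f := fun (n m : Rank) h => K2U.stab L (Subtype.coe_le_coe.mpr h))
    (⟨n, x⟩ : Σ n : Rank, K2U L n.1) m h
  exact e.symm

lemma StUInf.exists_of_eq_one {n : Rank} {x : StU L n.1} (hx : StUInf.of L n x = 1) :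
    ∃ (m : Rank) (h : n ≤ m), StU.stab L h x = 1 := by
  rw [← map_one (StUInf.of L n)] at hx
  obtain ⟨m, h, _, hm⟩ := Quotient.exact hx
  exact ⟨m, h, hm.trans (map_one _)⟩

lemma EUInf.exists_of_eq_one {n : Rank} {x : EU L n.1} (hx : EUInf.of L n x = 1) :
    ∃ (m : Rank) (h : n ≤ m), EU.stab L h x = 1 := by
  rw [← map_one (EUInf.of L n)] at hx
  obtain ⟨m, h, _, hm⟩ := Quotient.exact hx
  exact ⟨m, h, hm.trans (map_one _)⟩

lemma StUInf.toEU_of (n : Rank) (x : StU L n.1) :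
    StUInf.toEU L (StUInf.of L n x) = EUInf.of L n (StU.toEU L n.1 x) := rfl

lemma K2UInf.toStU_of (n : Rank) (x : K2U L n.1) :
    K2UInf.toStU L (K2UInf.of L n x) = StUInf.of L n x.1 := rfl

variable (L)

lemma K2UInf.range_toStU_le_center : (K2UInf.toStU L).range ≤ Subgroup.center (StUInf L) := by
  rintro _ ⟨z, rfl⟩
  rw [Subgroup.mem_center_iff]
  intro g
  obtain ⟨n, x, rfl⟩ := K2UInf.exists_of z
  obtain ⟨m, y, rfl⟩ := StUInf.exists_of g
  have hn : (3 : ℕ) ≤ n.1 := n.2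
  -- The rank must be strictly larger than `n`, since centrality needs at least one new index.
  let k : Rank := ⟨max n.1 m.1 + 1, by simp only [Set.mem_Ici]; omega⟩
  have h1 : n.1 < k.1 := by simp only [k]; omega
  have h2 : m ≤ k := by rw [← Subtype.coe_le_coe]; simp only [k]; omega
  rw [K2UInf.toStU_of, ← StUInf.of_stab h2, ← StUInf.of_stab (m := k) h1.le, ← map_mul,
    ← map_mul]
  exact congrArg _ (Subgroup.mem_center_iff.mp (K2U.stab_mem_center L h1 x) _)

lemma K2UInf.toStU_injective : Function.Injective (K2UInf.toStU L) := by
  rw [injective_iff_map_eq_one]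
  intro z hz
  obtain ⟨n, x, rfl⟩ := K2UInf.exists_of z
  obtain ⟨m, h, e⟩ := StUInf.exists_of_eq_one hz
  rw [← K2UInf.of_stab h, show K2U.stab L h x = 1 from Subtype.ext e, map_one]

lemma K2UInf.range_toStU : (K2UInf.toStU L).range = (StUInf.toEU L).ker := by
  apply le_antisymm
  · rintro _ ⟨z, rfl⟩
    obtain ⟨n, x, rfl⟩ := K2UInf.exists_of z
    rw [MonoidHom.mem_ker, K2UInf.toStU_of, StUInf.toEU_of, show StU.toEU L n.1 x.1 = 1 from x.2,
      map_one]
  · intro z hz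
    obtain ⟨n, x, rfl⟩ := StUInf.exists_of z
    obtain ⟨m, h, e⟩ := EUInf.exists_of_eq_one hz
    rw [← toEU_stab] at e
    exact ⟨K2UInf.of L m ⟨StU.stab L h x, e⟩, StUInf.of_stab h x⟩

lemma StUInf.toEU_surjective : Function.Surjective (StUInf.toEU L) := by
  intro z
  obtain ⟨n, x, rfl⟩ := EUInf.exists_of z
  obtain ⟨y, rfl⟩ := StU.toEU_surjective L n.1 x
  exact ⟨StUInf.of L n y, rfl⟩

/-- The rank `n + 2`. -/
def Rank.addTwo (n : Rank) : Rank := ⟨n.1 + 2, le_trans n.2 (Nat.le_add_right _ _)⟩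

lemma Rank.le_addTwo (n : Rank) : n ≤ n.addTwo := Nat.le_add_right n.1 2

lemma Rank.addTwo_mono {n m : Rank} (h : n ≤ m) : n.addTwo ≤ m.addTwo :=
  Nat.add_le_add_right (Subtype.coe_le_coe.mpr h) 2

lemma Rank.five_le_addTwo (n : Rank) : 5 ≤ n.addTwo.1 :=
  Nat.add_le_add_right (show 3 ≤ n.1 from n.2) 2

/-- The limit starts at rank 3 while lifting needs rank 5, so stage `n` is first sent to stage `n +
2`. -/
theorem StUInf.exists_lift {G H : Type*} [Group G] [Group H] (f : StUInf L →* G)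
    {ε : H →* G} (hε : ε.ker ≤ Subgroup.center H) (hf : ∀ x, f x ∈ ε.range) :
    ∃ η : StUInf L →* H, ε.comp η = f := by
  have h := fun n : Rank => StU.exists_lift L n.five_le_addTwo
    (f.comp (StUInf.of L n.addTwo)) hε fun x => hf _
  choose η hη using h
  -- Independently chosen lifts are compatible: both sides lift the same map on a perfect group.
  have hcompat : ∀ (n m : Rank) (hnm : n ≤ m), (η m).comp (StU.stab L (Rank.addTwo_mono hnm)) =
      η n := by
    intro n m hnm
    refine eq_of_comp_eq (StU.commutator_eq_top L n.five_le_addTwo) hε (MonoidHom.ext fun x => ?_)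
    have h1 := DFunLike.congr_fun (hη m) (StU.stab L (Rank.addTwo_mono hnm) x)
    have h2 := DFunLike.congr_fun (hη n) x
    refine h1.trans (Eq.trans ?_ h2.symm)
    exact congrArg f (StUInf.of_stab (Rank.addTwo_mono hnm) x)
  have hcompat' : ∀ (n m : Rank) (hnm : n ≤ m) (x : StU L n.1),
      η n (StU.stab L n.le_addTwo x) = η m (StU.stab L m.le_addTwo
        (StU.stab L (Subtype.coe_le_coe.mpr hnm) x)) := by
    intro n m hnm x
    rw [← hcompat n m hnm, MonoidHom.comp_apply, StU.stab_stab, StU.stab_stab]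
  let θ : StUInf L → H := DirectLimit.lift _
    (fun n : Rank => fun x => η n (StU.stab L n.le_addTwo x)) hcompat'
  have hθ : ∀ n x, θ (StUInf.of L n x) = η n (StU.stab L n.le_addTwo x) := fun _ _ => rfl
  refine ⟨MonoidHom.mk' θ fun x y => ?_, MonoidHom.ext fun x => ?_⟩
  · induction x, y using DirectLimit.induction₂ with
    | ih n x y =>
      change θ (StUInf.of L n x * StUInf.of L n y) = θ (StUInf.of L n x) * θ (StUInf.of L n y)
      rw [← map_mul, hθ, hθ, hθ, map_mul, map_mul]
  · obtain ⟨n, x, rfl⟩ := StUInf.exists_of x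
    change ε (θ (StUInf.of L n x)) = _
    rw [hθ]
    exact (DFunLike.congr_fun (hη n) _).trans (congrArg f (StUInf.of_stab n.le_addTwo x))

lemma StUInf.commutator_eq_top : commutator (StUInf L) = ⊤ := by
  rw [eq_top_iff]
  intro z _
  obtain ⟨n, x, rfl⟩ := StUInf.exists_of z
  rw [← StUInf.of_stab n.le_addTwo]
  have hx : StU.stab L n.le_addTwo x ∈ commutator (StU L n.addTwo.1) := by
    rw [StU.commutator_eq_top L n.five_le_addTwo]
    exact Subgroup.mem_top _
  have h := Subgroup.mem_map_of_mem (StUInf.of L n.addTwo) hx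
  rw [commutator_def, Subgroup.map_commutator] at h
  exact Subgroup.commutator_mono le_top le_top h

lemma StUInf.isSchurMultiplier :
    IsSchurMultiplier.{w} (K2UInf.toStU L) (StUInf.toEU L) where
  injective := K2UInf.toStU_injective L
  range_eq := K2UInf.range_toStU L
  universal := by
    refine ⟨⟨StUInf.toEU_surjective L, ?_⟩, fun H _ ε hε => ?_⟩
    · rw [← K2UInf.range_toStU]
      exact K2UInf.range_toStU_le_center L
    obtain ⟨η, hη⟩ := StUInf.exists_lift L (StUInf.toEU L) hε.2 fun x => hε.1 _
    exact ⟨η, hη, fun θ hθ =>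
      eq_of_comp_eq (StUInf.commutator_eq_top L) hε.2 (hθ.trans hη.symm)⟩

end limits

/-! ### The Schur multiplier and the second homology group -/

section homology

/-- The underlying set of the extension of `G` by `M` with the factor set `τ`. -/
@[ext]
structure CocycleExtension {G M : Type*} (τ : G → G → M) where
  fst : M
  snd : G

namespace CocycleExtension

variable {G M : Type*} [Group G] [AddCommGroup M] {τ : G → G → M}

/-- The group structure given by a 2-cocycle with respect to the trivial action. -/
@[reducible]
def group (hτ : ∀ g h k, τ h k - τ (g * h) k + τ g (h * k) - τ g h = 0) :
    Group (CocycleExtension τ) :=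
  letI : Mul (CocycleExtension τ) := ⟨fun x y => ⟨x.fst + y.fst + τ x.snd y.snd, x.snd * y.snd⟩⟩
  letI : One (CocycleExtension τ) := ⟨⟨-τ 1 1, 1⟩⟩
  letI : Inv (CocycleExtension τ) := ⟨fun x => ⟨-x.fst - τ x.snd⁻¹ x.snd - τ 1 1, x.snd⁻¹⟩⟩
  Group.ofLeftAxioms
    (fun x y z => by
      refine CocycleExtension.ext ?_ (mul_assoc _ _ _)
      change x.fst + y.fst + τ x.snd y.snd + z.fst + τ (x.snd * y.snd) z.snd =
        x.fst + (y.fst + z.fst + τ y.snd z.snd) + τ x.snd (y.snd * z.snd)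
      rw [← sub_eq_zero, ← neg_eq_zero, ← hτ x.snd y.snd z.snd]
      abel)
    (fun x => by
      refine CocycleExtension.ext ?_ (one_mul _)
      change -τ 1 1 + x.fst + τ 1 x.snd = x.fst
      have h := hτ 1 1 x.snd
      rw [one_mul, one_mul, sub_self, zero_add, sub_eq_zero] at h
      rw [h]
      abel)
    (fun x => by
      refine CocycleExtension.ext ?_ (inv_mul_cancel _)
      change -x.fst - τ x.snd⁻¹ x.snd - τ 1 1 + x.fst + τ x.snd⁻¹ x.snd = -τ 1 1
      abel)

end CocycleExtension

/-- The integers are lifted so that the coefficients live in the universe of the group. -/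
lemma addMonoidHom_ext_of_single {X N : Type*} [AddCommGroup N] {f g : (X →₀ ULift.{w} ℤ) →+ N}
    (h : ∀ x, f (Finsupp.single x 1) = g (Finsupp.single x 1)) : f = g := by
  refine Finsupp.addHom_ext fun x r => ?_
  have : Finsupp.single x r = r.down • Finsupp.single x (1 : ULift.{w} ℤ) := by
    rw [Finsupp.smul_single]
    congr 1
    ext
    simp
  rw [this, map_zsmul, map_zsmul, h]

/-- The additive homomorphism on `ℤ`-valued finitely supported functions with given values on the
basis. -/
noncomputable def liftSingle {X N : Type*} [AddCommGroup N] (c : X → N) :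
    (X →₀ ULift.{w} ℤ) →+ N :=
  Finsupp.liftAddHom fun x => (zmultiplesHom N (c x)).comp AddEquiv.ulift.toAddMonoidHom

lemma liftSingle_single {X N : Type*} [AddCommGroup N] (c : X → N) (x : X) :
    liftSingle.{w} c (Finsupp.single x 1) = c x := by
  have : AddEquiv.ulift (1 : ULift.{w} ℤ) = 1 := rfl
  simp [liftSingle, this]

lemma nonempty_addEquiv_of_ker_eq {A B C : Type*} [AddCommGroup A] [AddCommGroup B]
    [AddCommGroup C] {f : A →+ B} {g : A →+ C} (hf : Function.Surjective f)
    (hg : Function.Surjective g) (h : f.ker = g.ker) : Nonempty (B ≃+ C) :=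
  ⟨(QuotientAddGroup.quotientKerEquivOfSurjective f hf).symm.trans
    ((QuotientAddGroup.quotientAddEquivOfEq h).trans
      (QuotientAddGroup.quotientKerEquivOfSurjective g hg))⟩

/-- Homomorphisms from a universal central extension to abelian groups are trivial. -/
lemma IsUniversalCentralExtension.eq_one {U : Type*} {G : Type u} [Group U] [Group G] {π : U →* G}
    (h : IsUniversalCentralExtension.{u} π) {A : Type u} [CommGroup A] (f : U →* A) : f = 1 := by
  have hc : IsCentralExtension (MonoidHom.fst G A) := by
    refine ⟨fun g => ⟨(g, 1), rfl⟩, ?_⟩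
    rintro ⟨g, a⟩ hg
    obtain rfl : g = 1 := hg
    rw [Subgroup.mem_center_iff]
    rintro ⟨g, b⟩
    exact Prod.ext (by simp) (mul_comm b a)
  obtain ⟨η, -, hη⟩ := h.2 (G × A) (MonoidHom.fst G A) hc
  -- Both `(π, f)` and `(π, 1)` lift `π` to the trivial central extension `G × A`.
  have h1 := hη (π.prod f) (MonoidHom.ext fun _ => rfl)
  have h2 := hη (π.prod 1) (MonoidHom.ext fun _ => rfl)
  exact MonoidHom.ext fun x => congrArg Prod.snd (DFunLike.congr_fun (h1.trans h2.symm) x)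

open groupHomology in
/-- The kernel of the universal central extension of `G` is `H₂(G, ℤ)`. -/
theorem IsSchurMultiplier.nonempty_addEquiv_H2 {K : Type*} {U G : Type u} [Group K] [Group U]
    [Group G] {i : K →* U} {π : U →* G} (h : IsSchurMultiplier.{u} i π) :
    Nonempty (Additive K ≃+ H2 (Rep.trivial (ULift.{u} ℤ) G (ULift.{u} ℤ))) := by
  have hcen : ∀ (x : K) (y : U), y * i x = i x * y := fun x y =>
    Subgroup.mem_center_iff.mp (h.universal.1.2 (h.range_eq ▸ ⟨x, rfl⟩)) y
  let _ : CommGroup K :=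
    { (inferInstance : Group K) with
      mul_comm := fun x y => h.injective (by rw [map_mul, map_mul, hcen]) }
  let A := Rep.trivial (ULift.{u} ℤ) G (ULift.{u} ℤ)
  let M := (G × G →₀ ULift.{u} ℤ) ⧸ (boundaries₂ A).toAddSubgroup
  let q : (G × G →₀ ULift.{u} ℤ) →+ M := QuotientAddGroup.mk' _
  have hq : ∀ x, q x = 0 ↔ x ∈ boundaries₂ A := fun x => QuotientAddGroup.eq_zero_iff x
  -- The tautological 2-cocycle: dividing by boundaries imposes exactly the cocycle identity. It is
  -- not normalized, so the identity of the extension is `(-τ(1, 1), 1)` and corrections `τ 1 1`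
  -- appear below.
  let τ : G → G → M := fun g h => q (Finsupp.single (g, h) 1)
  have hτ : ∀ g h k, τ h k - τ (g * h) k + τ g (h * k) - τ g h = 0 := by
    intro g h k
    simp only [τ, ← map_sub, ← map_add]
    rw [hq]
    exact ⟨Finsupp.single (g, h, k) 1, d₃₂_single (A := A) _ _⟩
  let _ : Group (CocycleExtension τ) := CocycleExtension.group hτ
  have hmul : ∀ x y : CocycleExtension τ,
    x * y = ⟨x.fst + y.fst + τ x.snd y.snd, x.snd * y.snd⟩ := fun _ _ => rfl
  have hτ1 : ∀ g, τ 1 g = τ 1 1 := fun g => by simpa [sub_eq_zero] using hτ 1 1 g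
  have hτ2 : ∀ g, τ g 1 = τ 1 1 := fun g => by
    have := hτ g 1 1
    simp only [mul_one, sub_add_cancel] at this
    exact (sub_eq_zero.mp this).symm
  let ε : CocycleExtension τ →* G := MonoidHom.mk' (fun x => x.snd) fun _ _ => rfl
  have hε : IsCentralExtension ε := by
    refine ⟨fun g => ⟨⟨0, g⟩, rfl⟩, ?_⟩
    rintro ⟨m, g⟩ hg
    obtain rfl : g = 1 := hg
    rw [Subgroup.mem_center_iff]
    rintro ⟨m', g⟩
    rw [hmul, hmul]
    simp only [hτ1, hτ2, mul_one, one_mul, add_comm m]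
  obtain ⟨η, hη, -⟩ := h.universal.2 _ ε hε
  have hηsnd : ∀ x, (η x).snd = π x := fun x => DFunLike.congr_fun hη x
  let s : G → U := Function.surjInv h.universal.1.1
  have hs : ∀ g, π (s g) = g := Function.surjInv_eq h.universal.1.1
  have hπi : ∀ x, π (i x) = 1 := fun x => MonoidHom.mem_ker.mp (h.range_eq ▸ ⟨x, rfl⟩)
  have hex : ∀ p : G × G, ∃ x : K, i x = s p.1 * s p.2 * (s (p.1 * p.2))⁻¹ := fun p => by
    have : s p.1 * s p.2 * (s (p.1 * p.2))⁻¹ ∈ i.range := by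
      rw [h.range_eq, MonoidHom.mem_ker]
      simp [hs]
    exact this
  choose c hc using hex
  have hc' : ∀ g h, s g * s h = i (c (g, h)) * s (g * h) := fun g h => by
    rw [hc]; group
  have hcoc : ∀ g h k, c (g, h) * c (g * h, k) = c (h, k) * c (g, h * k) := by
    intro g h' k
    apply h.injective
    rw [map_mul, map_mul, ← mul_left_inj (s (g * h' * k)), mul_assoc, ← hc', ← mul_assoc, ← hc',
      mul_assoc g, mul_assoc (i _) (i _), ← hc', ← mul_assoc, ← hcen, mul_assoc (s g), mul_assoc (s g),
      ← hc']
  let φ : (G × G →₀ ULift.{u} ℤ) →+ Additive K := liftSingle fun p => Additive.ofMul (c p)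
  have hφ : ∀ g h, φ (Finsupp.single (g, h) 1) = Additive.ofMul (c (g, h)) :=
    fun g h => liftSingle_single _ _
  have hφB : ∀ x ∈ boundaries₂ A, φ x = 0 := by
    rintro _ ⟨y, rfl⟩
    have : φ.comp (d₃₂ A).hom.toAddMonoidHom = 0 := by
      refine addMonoidHom_ext_of_single fun ⟨g, h, k⟩ => ?_
      change φ (d₃₂ A (Finsupp.single (g, h, k) 1)) = 0
      rw [d₃₂_single]
      simp only [map_sub, map_add]
      change φ (Finsupp.single (h, k) 1) - φ (Finsupp.single (g * h, k) 1) +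
        φ (Finsupp.single (g, h * k) 1) - φ (Finsupp.single (g, h) 1) = 0
      rw [hφ, hφ, hφ, hφ, sub_eq_zero, sub_add_eq_add_sub, sub_eq_iff_eq_add, ← ofMul_mul,
        ← ofMul_mul, hcoc]
    exact DFunLike.congr_fun this y
  let φ' : M →+ Additive K := QuotientAddGroup.lift _ φ hφB
  have hφ' : ∀ x, φ' (q x) = φ x := fun x => QuotientAddGroup.lift_mk' _ _ x
  let d : (G × G →₀ ULift.{u} ℤ) →+ (G →₀ ULift.{u} ℤ) := (d₂₁ A).hom.toAddMonoidHom
  have hd : ∀ g h, d (Finsupp.single (g, h) 1) =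
      Finsupp.single h 1 - Finsupp.single (g * h) 1 + Finsupp.single g 1 :=
    fun g h => d₂₁_single (A := A) _ _
  let d' : M →+ (G →₀ ULift.{u} ℤ) := QuotientAddGroup.lift _ d fun x hx =>
    boundaries₂_le_cycles₂ A hx
  have hd' : ∀ x, d' (q x) = d x := fun x => QuotientAddGroup.lift_mk' _ _ x
  let θ : CocycleExtension τ →* U := MonoidHom.mk' (fun x => i (φ' x.fst).toMul * s x.snd) <| by
    intro x y
    have e : (φ' (x * y).fst).toMul =
        (φ' x.fst).toMul * (φ' y.fst).toMul * c (x.snd, y.snd) := by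
      rw [hmul]
      simp only [τ, map_add, hφ', hφ, toMul_add, toMul_ofMul]
    rw [e, map_mul, map_mul, mul_assoc (_ * _), hmul, ← hc']
    simp only [mul_assoc]
    rw [← mul_assoc (i _) (s x.snd), ← hcen (φ' y.fst).toMul]
    simp only [mul_assoc]
  -- Uniqueness in the universal property of `π`, applied to `π` itself.
  have hθη : ∀ x, θ (η x) = x := by
    intro x
    refine DFunLike.congr_fun ((h.universal.2 U π h.universal.1).unique (y₁ := θ.comp η)
      (y₂ := MonoidHom.id U) (MonoidHom.ext fun y => ?_) rfl) x
    change π (i _ * s (η y).snd) = π y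
    rw [map_mul, hπi, one_mul, hs, hηsnd]
  -- Multiplicative because `d τ(g, h) = [h] - [gh] + [g]`. Homomorphisms from `U` to abelian groups
  -- are trivial, so `ρ ∘ η = 1`; this puts the image of `ψ` among classes of cycles.
  let ρ : CocycleExtension τ →* Multiplicative (G →₀ ULift.{u} ℤ) :=
    MonoidHom.mk' (fun x => Multiplicative.ofAdd (d' x.fst + Finsupp.single x.snd 1)) <| by
      intro x y
      rw [← ofAdd_add, hmul]
      simp only [τ, map_add, hd', hd]
      congr 1
      abel
  have hρ : ∀ x, d' (η x).fst + Finsupp.single (η x).snd 1 = 0 := fun x =>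
    congrArg Multiplicative.toAdd (DFunLike.congr_fun (h.universal.eq_one (ρ.comp η)) x)
  let ψ : Additive K →+ M := AddMonoidHom.mk' (fun x => (η (i x.toMul)).fst + τ 1 1) <| by
    intro x y
    rw [toMul_add, map_mul, map_mul, hmul]
    simp only [hηsnd, hπi]
    abel
  have hψ : ∀ x, ψ x = (η (i x.toMul)).fst + τ 1 1 := fun _ => rfl
  have hs1 : i (c (1, 1)) = s 1 := by rw [hc]; simp
  have hφψ : ∀ x, φ' (ψ x) = x := by
    intro x
    have e := hθη (i x.toMul)
    change i (φ' (η _).fst).toMul * s (η _).snd = _ at e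
    rw [hηsnd, hπi, ← hs1, ← map_mul] at e
    rw [hψ, map_add, hφ', hφ]
    exact h.injective e
  have hdψ : ∀ x, d' (ψ x) = 0 := by
    intro x
    have e := hρ (i x.toMul)
    rw [hηsnd, hπi] at e
    rw [hψ, map_add, hd', hd]
    simpa using e
  let T : (G →₀ ULift.{u} ℤ) →+ M := liftSingle fun g => (η (s g)).fst
  have hT : ∀ g, T (Finsupp.single g 1) = (η (s g)).fst := fun g => liftSingle_single _ _
  -- On cycles the term `T ∘ d` vanishes, so `ψ ∘ φ = q` there: a cycle killed by `φ` is a boundary.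
  have hqT : ψ.comp φ = q + T.comp d := by
    refine addMonoidHom_ext_of_single fun ⟨g, h⟩ => ?_
    change ψ (φ _) = q _ + T (d _)
    have e := congrArg (fun x => (η x).fst) (hc' g h)
    simp only [map_mul, hmul, hηsnd, hs, hπi, hτ1] at e
    rw [hφ, hd, hψ, map_add, map_sub, hT, hT, hT, toMul_ofMul]
    have e' : (η (i (c (g, h)))).fst + τ 1 1 =
        (η (s g)).fst + (η (s h)).fst + τ g h - (η (s (g * h))).fst := by
      rw [e]; abel
    rw [e']
    simp only [τ]
    abel
  let Φ : cycles₂ A →+ Additive K := φ.comp (cycles₂ A).subtype.toAddMonoidHom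
  have hΦ : ∀ x, Φ x = φ x.1 := fun _ => rfl
  have hΦs : Function.Surjective Φ := by
    intro x
    obtain ⟨z, hz⟩ := QuotientAddGroup.mk'_surjective _ (ψ x)
    have hz' : q z = ψ x := hz
    refine ⟨⟨z, ?_⟩, ?_⟩
    · change d z = 0
      rw [← hd', hz', hdψ]
    · rw [hΦ, ← hφ', hz', hφψ]
  have hH : Function.Surjective (H2π A).hom.toAddMonoidHom :=
    (ModuleCat.epi_iff_surjective (H2π A)).mp inferInstance
  -- Both `K` and `H₂` are quotients of the group of cycles, and both kernels are the boundaries.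
  refine nonempty_addEquiv_of_ker_eq hΦs hH (AddSubgroup.ext fun x => ?_)
  rw [AddMonoidHom.mem_ker, AddMonoidHom.mem_ker]
  change _ ↔ H2π A x = 0
  rw [H2π_eq_zero_iff, hΦ]
  refine ⟨fun hx => ?_, hφB _⟩
  have e := DFunLike.congr_fun hqT x.1
  change ψ (φ x.1) = q x.1 + T (d x.1) at e
  rw [hx, show d x.1 = 0 from x.2, map_zero, map_zero, add_zero] at e
  exact (hq _).mp e.symm

end homology

end OddUnitary

theorem theorem3 {R : Type u} [Ring R] {J : OddUnitary.PseudoInvolution R}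
    {V : Type v} [AddCommGroup V] [Module Rᵐᵒᵖ V] {B : OddUnitary.AntiHermitianForm J V}
    (L : OddUnitary.OddFormParameter B) :
    (∀ n : ℕ, 5 ≤ n →
      (OddUnitary.K2U L n ≤ Subgroup.center (OddUnitary.StU L n) →
        OddUnitary.IsSchurMultiplier.{w} (OddUnitary.K2U L n).subtype (OddUnitary.StU.toEU L n)) ∧
      (Function.Surjective (OddUnitary.K2U.stab L (Nat.sub_le n 1)) →
        OddUnitary.K2U L n ≤ Subgroup.center (OddUnitary.StU L n))) ∧
    (OddUnitary.K2UInf.toStU L).range ≤ Subgroup.center (OddUnitary.StUInf L) ∧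
    OddUnitary.IsSchurMultiplier.{w} (OddUnitary.K2UInf.toStU L) (OddUnitary.StUInf.toEU L) ∧
    Nonempty (Additive (OddUnitary.K2UInf L) ≃+
      groupHomology.H2 (Rep.trivial (ULift.{max u v} ℤ) (OddUnitary.EUInf L)
        (ULift.{max u v} ℤ))) :=
  ⟨fun _ hn => ⟨OddUnitary.StU.isSchurMultiplier L hn,
      OddUnitary.K2U.le_center_of_stab_surjective L hn⟩,
    OddUnitary.K2UInf.range_toStU_le_center L, OddUnitary.StUInf.isSchurMultiplier L,
    (OddUnitary.StUInf.isSchurMultiplier L).nonempty_addEquiv_H2⟩
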